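/- Let $\mathcal H$ be a complex Hilbert space, $\Gamma$ a selfadjoint unitary operator on $\mathcal H$, and $\gamma(a)=\Gamma a\Gamma$ for $a\in B(\mathcal H)$. Let $Q$ be a (possibly unbounded) selfadjoint operator on $\mathcal H$ with domain $D(Q)$ which is odd, i.e. $\Gamma Q\Gamma=-Q$. The superderivation $\delta=[Q,\cdot\,]$ is the linear operator on $B(\mathcal H)$ with domain $D(\delta)$ defined as follows: $a\in D(\delta)$ if and only if there is a bounded operator $b$ with $\gamma(a)Q\subset Qa-b$, that is, for every $\psi\in D(Q)$ one has $a\psi\in D(Q)$ and $\gamma(a)Q\psi=Qa\psi-b\psi$; then $b$ is unique and $\delta(a)=b$. Set $D(\delta^{1})=D(\delta)$, $D(\delta^{n+1})=\{a\in D(\delta): \delta(a)\in D(\delta^n)\}$ and $C^\infty(\delta)=\bigcap_{n\ge 1}D(\delta^n)$. Let $H=Q^2$, with domain $\{\psi\in D(Q): Q\psi\in D(Q)\}$. Then $iH$ generates a strongly continuous one-parameter unitary group $e^{itH}$ on $\mathcal H$ (for all $\psi,\varphi\in\mathcal H$: $\psi\in D(H)$ and $H\psi=\varphi$ if and only if $\frac{d}{dt}e^{itH}\psi|_{t=0}=i\varphi$).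 For $a\in B(\mathcal H)$ and $f\in L^1(\mathbb R)$ (complex-valued) put $$a_f=\int_{\mathbb R}e^{itH}ae^{-itH}f(t)\,dt,$$ the integral being taken in the strong sense, $a_f\psi=\int_{\mathbb R}f(t)\,e^{itH}ae^{-itH}\psi\,dt$ for $\psi\in\mathcal H$. Then the following hold. 1. If $a\in D(\delta)$ and $f\in C_c^\infty(\mathbb R)$, then $a_f\in C^\infty(\delta)$. 2. $C^\infty(\delta)$ is a core for $\delta$ with respect to the $\sigma$-weak topology: $\delta$ coincides with the ($\sigma$-weak)–($\sigma$-weak) closure of its restriction to $C^\infty(\delta)$, i.e. the graph of $\delta$ is the closure of $\{(a,\delta(a)): a\in C^\infty(\delta)\}$ in $B(\mathcal H)\times B(\mathcal H)$ for the product of the $\sigma$-weak topologies. 3. $C^\infty(\delta)$ is dense in $B(\mathcal H)$ in the strong operator topology. -/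

import Mathlib

open scoped ContDiff

namespace SuperDer

noncomputable section

/-! ### Powers of unbounded operators -/

/-- The domain of the `n`-th power of a partially defined operator `T : M → M`:
`D(T⁰) = M` and `D(Tⁿ⁺¹) = {x ∈ D(T) | T x ∈ D(Tⁿ)}`. -/
def powDomain {M : Type*} [AddCommGroup M] [Module ℂ M] (T : M →ₗ.[ℂ] M) : ℕ → Submodule ℂ M
  | 0 => ⊤
  | n + 1 => ((powDomain T n).comap T.toFun).map T.domain.subtype

/-- `C^∞(T) = ⋂ₙ D(Tⁿ)`, the intersection over `n ≥ 1`. -/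
def smoothDomain {M : Type*} [AddCommGroup M] [Module ℂ M] (T : M →ₗ.[ℂ] M) : Submodule ℂ M :=
  ⨅ n : ℕ, powDomain T (n + 1)

/-- The square `T²` of a partially defined operator, with domain
`{x ∈ D(T) | T x ∈ D(T)}`. -/
def square {M : Type*} [AddCommGroup M] [Module ℂ M] (T : M →ₗ.[ℂ] M) : M →ₗ.[ℂ] M :=
  T.comp (T.domRestrict ((T.domain.comap T.toFun).map T.domain.subtype)) (by
    rintro ⟨x, hx⟩
    obtain ⟨⟨y, hy, hyx⟩, hx'⟩ := Submodule.mem_inf.mp hx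
    obtain rfl : (y : M) = x := hyx
    exact hy)

variable {E : Type*} [NormedAddCommGroup E] [InnerProductSpace ℂ E]

/-! ### The superderivation -/

/-- `Γ Q Γ = -Q`, equality of unbounded operators: the domain `{ψ | Γ ψ ∈ D(Q)}` of the
left-hand side equals `D(Q)`, and the two sides agree there. -/
def IsOdd (Γ : E →L[ℂ] E) (Q : E →ₗ.[ℂ] E) : Prop :=
  (∀ ψ : E, Γ ψ ∈ Q.domain ↔ ψ ∈ Q.domain) ∧
    ∀ (ψ : Q.domain) (h : Γ ψ ∈ Q.domain), Γ (Q ⟨Γ ψ, h⟩) = -Q ψ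

/-- The grading `γ = Ad Γ` of `B(H)`, for a selfadjoint unitary `Γ` (so that `Γ⁻¹ = Γ`). -/
def grading (Γ a : E →L[ℂ] E) : E →L[ℂ] E := Γ * a * Γ

/-- The relation `γ(a) Q ⊆ Q a - b` of unbounded operators; here `D(γ(a) Q) = D(Q)` and
`D(Q a - b) = {ψ | a ψ ∈ D(Q)}`. -/
def SuperCommutes (Γ : E →L[ℂ] E) (Q : E →ₗ.[ℂ] E) (a b : E →L[ℂ] E) : Prop :=
  ∀ ψ : Q.domain, ∃ h : a ψ ∈ Q.domain, grading Γ a (Q ψ) = Q ⟨a ψ, h⟩ - b ψ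

/-- The set of pairs `(a, b)` with `γ(a) Q ⊆ Q a - b`. -/
def superderivationGraph (Γ : E →L[ℂ] E) (Q : E →ₗ.[ℂ] E) :
    Submodule ℂ ((E →L[ℂ] E) × (E →L[ℂ] E)) where
  carrier := {p | SuperCommutes Γ Q p.1 p.2}
  add_mem' := by
    rintro ⟨a, b⟩ ⟨a', b'⟩ h h' ψ
    obtain ⟨h1, h2⟩ := h ψ
    obtain ⟨h1', h2'⟩ := h' ψ
    refine ⟨Q.domain.add_mem h1 h1', ?_⟩
    have e : Q ⟨(a + a') ψ, Q.domain.add_mem h1 h1'⟩ = Q ⟨a ψ, h1⟩ + Q ⟨a' ψ, h1'⟩ := by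
      rw [← LinearPMap.map_add]; rfl
    have g : grading Γ (a + a') (Q ψ) = grading Γ a (Q ψ) + grading Γ a' (Q ψ) := by
      simp [grading]
    simp only at h2 h2'
    change grading Γ (a + a') (Q ψ) = Q ⟨(a + a') ψ, _⟩ - (b + b') ψ
    rw [e, g, h2, h2', add_apply]
    abel
  zero_mem' := by
    intro ψ
    refine ⟨Q.domain.zero_mem, ?_⟩
    have e : Q ⟨(0 : E →L[ℂ] E) ψ, Q.domain.zero_mem⟩ = 0 := LinearPMap.map_zero Q
    change grading Γ 0 (Q ψ) = Q ⟨(0 : E →L[ℂ] E) ψ, _⟩ - (0 : E →L[ℂ] E) ψ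
    rw [e]
    simp [grading]
  smul_mem' := by
    rintro c ⟨a, b⟩ h ψ
    obtain ⟨h1, h2⟩ := h ψ
    refine ⟨Q.domain.smul_mem c h1, ?_⟩
    have e : Q ⟨(c • a) ψ, Q.domain.smul_mem c h1⟩ = c • Q ⟨a ψ, h1⟩ := by
      rw [← LinearPMap.map_smul]; rfl
    have g : grading Γ (c • a) (Q ψ) = c • grading Γ a (Q ψ) := by
      simp [grading]
    simp only at h2
    change grading Γ (c • a) (Q ψ) = Q ⟨(c • a) ψ, _⟩ - (c • b) ψ
    rw [e, g, h2, smul_sub]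
    rfl

/-- The superderivation `δ = [Q, ·]` as a partially defined operator on `B(H)`: `a ∈ D(δ)` iff
`γ(a) Q ⊆ Q a - b` for some bounded `b`, and then `δ(a) = b`. -/
def superderivation (Γ : E →L[ℂ] E) (Q : E →ₗ.[ℂ] E) : (E →L[ℂ] E) →ₗ.[ℂ] (E →L[ℂ] E) :=
  (superderivationGraph Γ Q).toLinearPMap

/-- If `Q` is densely defined then `b` is determined by `a`, so the graph of `δ` is the set of
pairs `(a, b)` with `γ(a) Q ⊆ Q a - b`. -/
theorem mem_graph_superderivation {Γ : E →L[ℂ] E} {Q : E →ₗ.[ℂ] E}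
    (hQ : Dense (Q.domain : Set E)) {a b : E →L[ℂ] E} :
    (a, b) ∈ (superderivation Γ Q).graph ↔ SuperCommutes Γ Q a b := by
  unfold superderivation
  rw [Submodule.toLinearPMap_graph_eq]
  · rfl
  · rintro ⟨x, y⟩ hx hx0
    obtain rfl : x = 0 := hx0
    have key : ∀ ψ ∈ (Q.domain : Set E), y ψ = (0 : E →L[ℂ] E) ψ := by
      intro ψ hψ
      obtain ⟨h1, h2⟩ := hx ⟨ψ, hψ⟩
      have e : Q ⟨(0 : E →L[ℂ] E) ψ, h1⟩ = 0 := LinearPMap.map_zero Q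
      simp only [] at h2
      rw [e] at h2
      simpa [grading] using h2
    exact ContinuousLinearMap.ext fun ψ =>
      congrFun (Continuous.ext_on hQ y.continuous (0 : E →L[ℂ] E).continuous key) ψ

/-! ### Unitary groups and time smoothing -/

/-- A strongly continuous one-parameter group of unitary operators on `E`. -/
structure UnitaryGroup (E : Type*) [NormedAddCommGroup E] [InnerProductSpace ℂ E] where
  /-- The operator at time `t`. -/
  U : ℝ → E →L[ℂ] E
  zero : U 0 = 1
  add : ∀ s t, U (s + t) = U s * U t
  norm_apply : ∀ t ψ, ‖U t ψ‖ = ‖ψ‖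
  continuous_apply : ∀ ψ, Continuous fun t => U t ψ

/-- The trivial one-parameter group. -/
instance : Inhabited (UnitaryGroup E) :=
  ⟨⟨fun _ => 1, rfl, fun _ _ => (one_mul _).symm, fun _ _ => rfl, fun _ => continuous_const⟩⟩

/-- `H` is the infinitesimal generator of `V` in the sense of Stone's theorem: `D(H)` is the set of
vectors `ψ` for which `t ↦ V t ψ` is differentiable at `0`, and then `i H ψ` is the derivative. -/
def UnitaryGroup.HasGenerator (V : UnitaryGroup E) (H : E →ₗ.[ℂ] E) : Prop :=
  ∀ ψ φ : E, (ψ, φ) ∈ H.graph ↔ HasDerivAt (fun t : ℝ => V.U t ψ) (Complex.I • φ) 0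

open Classical in
/-- The unitary group `t ↦ e^{itH}`: the (unique) strongly continuous one-parameter unitary group
with generator `H`. It exists if `H` is selfadjoint; if there is none, the value is the trivial
group. -/
def expI (H : E →ₗ.[ℂ] E) : UnitaryGroup E :=
  if h : ∃ V : UnitaryGroup E, V.HasGenerator H then h.choose else default

theorem UnitaryGroup.continuous_conj (V : UnitaryGroup E) (a : E →L[ℂ] E) (ψ : E) :
    Continuous fun t : ℝ => V.U t (a (V.U (-t) ψ)) := by
  have hg : Continuous fun t : ℝ => a (V.U (-t) ψ) :=
    a.continuous.comp ((V.continuous_apply ψ).comp continuous_neg)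
  rw [continuous_iff_continuousAt]
  intro t₀
  have h1 : Filter.Tendsto (fun t : ℝ => V.U t (a (V.U (-t) ψ) - a (V.U (-t₀) ψ)))
      (nhds t₀) (nhds 0) := by
    rw [tendsto_zero_iff_norm_tendsto_zero]
    simp only [V.norm_apply]
    have := (hg.tendsto t₀).sub_const (a (V.U (-t₀) ψ))
    rw [sub_self] at this
    simpa using this.norm
  have h2 := (V.continuous_apply (a (V.U (-t₀) ψ))).tendsto t₀
  have h3 := h1.add h2
  rw [zero_add] at h3
  refine h3.congr fun t => ?_
  simp

theorem UnitaryGroup.norm_conj_le (V : UnitaryGroup E) (a : E →L[ℂ] E) (ψ : E) (t : ℝ) :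
    ‖V.U t (a (V.U (-t) ψ))‖ ≤ ‖a‖ * ‖ψ‖ := by
  rw [V.norm_apply]
  exact (a.le_opNorm _).trans_eq (by rw [V.norm_apply])

theorem UnitaryGroup.integrable_conj (V : UnitaryGroup E) {f : ℝ → ℂ}
    (hf : MeasureTheory.Integrable f) (a : E →L[ℂ] E) (ψ : E) :
    MeasureTheory.Integrable fun t : ℝ => f t • V.U t (a (V.U (-t) ψ)) :=
  hf.smul_bdd (‖a‖ * ‖ψ‖) (V.continuous_conj a ψ).aestronglyMeasurable
    (Filter.Eventually.of_forall (V.norm_conj_le a ψ))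

open Classical in
/-- The time-smoothed operator `a_f = ∫ V(t) a V(-t) f(t) dt` for `f ∈ L¹(ℝ)`. The integral
converges in the strong operator topology, that is,
`a_f ψ = ∫ f(t) V(t) a V(-t) ψ dt` for every vector `ψ`. -/
def UnitaryGroup.smear (V : UnitaryGroup E) (a : E →L[ℂ] E) (f : ℝ → ℂ) : E →L[ℂ] E :=
  if hf : MeasureTheory.Integrable f then
    LinearMap.mkContinuous
      { toFun := fun ψ => ∫ t : ℝ, f t • V.U t (a (V.U (-t) ψ))
        map_add' := fun ψ φ => by
          rw [← MeasureTheory.integral_add (V.integrable_conj hf a ψ) (V.integrable_conj hf a φ)]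
          simp
        map_smul' := fun c ψ => by
          rw [RingHom.id_apply, ← MeasureTheory.integral_smul]
          simp only [map_smul, smul_comm c] }
      ((∫ t : ℝ, ‖f t‖) * ‖a‖) (fun ψ => by
        rw [mul_assoc, ← MeasureTheory.integral_mul_const]
        refine MeasureTheory.norm_integral_le_of_norm_le (hf.norm.mul_const _)
          (Filter.Eventually.of_forall fun t => ?_)
        rw [norm_smul]
        exact mul_le_mul_of_nonneg_left (V.norm_conj_le a ψ t) (norm_nonneg _))
  else 0

theorem UnitaryGroup.smear_apply (V : UnitaryGroup E) (a : E →L[ℂ] E) {f : ℝ → ℂ}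
    (hf : MeasureTheory.Integrable f) (ψ : E) :
    V.smear a f ψ = ∫ t : ℝ, f t • V.U t (a (V.U (-t) ψ)) := by
  rw [UnitaryGroup.smear, dif_pos hf]
  rfl

/-! ### The `σ`-weak topology -/

/-- The `σ`-weak topology of `B(H)`: the coarsest topology for which the functionals
`a ↦ ∑ₙ ⟨ξₙ, a ηₙ⟩` are continuous, for all sequences with `∑ₙ ‖ξₙ‖² < ∞`, `∑ₙ ‖ηₙ‖² < ∞`. -/
@[reducible] def sigmaWeakTopology (E : Type*) [NormedAddCommGroup E] [InnerProductSpace ℂ E] :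
    TopologicalSpace (E →L[ℂ] E) :=
  TopologicalSpace.induced
    (fun a (p : lp (fun _ : ℕ => E) 2 × lp (fun _ : ℕ => E) 2) =>
      ∑' n : ℕ, inner ℂ (p.1 n) (a (p.2 n)))
    Pi.topologicalSpace

/-- `S` is a core for `T` with respect to the `σ`-weak topology: `S ⊆ D(T)` and `T` is the
(`σ`-weak)-(`σ`-weak) closure of its restriction to `S`, in terms of graphs. -/
def IsSigmaWeakCore (T : (E →L[ℂ] E) →ₗ.[ℂ] (E →L[ℂ] E)) (S : Submodule ℂ (E →L[ℂ] E)) : Prop :=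
  S ≤ T.domain ∧
    @closure _ (@instTopologicalSpaceProd _ _ (sigmaWeakTopology E) (sigmaWeakTopology E))
      ((T.domRestrict S).graph : Set ((E →L[ℂ] E) × (E →L[ℂ] E))) = T.graph

/-- `S` is dense in `B(H)` in the strong operator topology (topology of pointwise convergence). -/
def IsStronglyDense (S : Submodule ℂ (E →L[ℂ] E)) : Prop :=
  Dense (ContinuousLinearMap.toPointwiseConvergenceCLM ℂ (RingHom.id ℂ) E E ''
    (S : Set (E →L[ℂ] E)))

end

end SuperDer

/-! ### Graphs and resolvents of a selfadjoint operator. -/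

namespace SuperDer

variable {E : Type*} [NormedAddCommGroup E] [InnerProductSpace ℂ E]

/-! The group `e^{itH}`, `H = Q²`, is built from the bounded operator `R = (1 + Q²)⁻¹` as `e^{it(1/R
- 1)}` by continuous functional calculus (`exists_hasGenerator_square`). Bounded operators commuting
with `Q²` commute with the group. Hence the group preserves the graph of `Q` and commutes with `Γ`.

Tested against vectors of `D(Q)`, the relation `γ(a)Q ⊆ Qa - b` becomes a scalar identity, linear in
`(a, b)` (`superCommutes_iff_inner`). It therefore survives averaging in time: `δ(a_f) = δ(a)_f`.
Formally `δ² = [H, ·]`, which is `-i` times the time derivative of `e^{itH} a e^{-itH}`. Integration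
by parts gives `δ(δ(a)_f) = i a_{f'}` (`SuperCommutes.smear_deriv`). Alternating the two formulas
shows that `a_f` lies in every `D(δⁿ)`.

For mollifiers `f`, both `a_f → a` and `δ(a)_f → δ(a)` strongly and boundedly, hence `σ`-weakly.
Since the scalar identity is `σ`-weakly closed, the core property follows. For density, any `a` is
the strong limit of `B a B` with `B = ic(Q + ic)⁻¹`, `c → ∞`; these lie in `D(δ)`, and smoothing
moves them into `C^∞(δ)`. -/

theorem mem_graph_square {M : Type*} [AddCommGroup M] [Module ℂ M] {T : M →ₗ.[ℂ] M} {x z : M} :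
    (x, z) ∈ (square T).graph ↔ ∃ y, (x, y) ∈ T.graph ∧ (y, z) ∈ T.graph := by
  constructor
  · intro h
    obtain ⟨⟨w, hw⟩, rfl, rfl⟩ := (LinearPMap.mem_graph_iff _).1 h
    obtain ⟨hw1, hw2⟩ := Submodule.mem_inf.mp hw
    obtain ⟨⟨y, hy⟩, hy', rfl⟩ := hw1
    exact ⟨T ⟨y, hy⟩, T.mem_graph ⟨y, hy⟩, T.mem_graph ⟨T ⟨y, hy⟩, hy'⟩⟩
  · rintro ⟨y, h1, h2⟩
    obtain ⟨⟨x, hx⟩, rfl, rfl⟩ := (LinearPMap.mem_graph_iff _).1 h1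
    obtain ⟨⟨w, hw⟩, hw', rfl⟩ := (LinearPMap.mem_graph_iff _).1 h2
    simp only at hw'
    subst hw'
    exact (square T).mem_graph ⟨x, ⟨⟨⟨x, hx⟩, hw, rfl⟩, hx⟩⟩

/-- Because `Q = Q*`, membership in the graph can be tested weakly; later domain claims reduce to
scalar identities in this way. -/
theorem mem_graph_iff_of_isSelfAdjoint [CompleteSpace E] {Q : E →ₗ.[ℂ] E} (hQ : IsSelfAdjoint Q)
    {x y : E} :
    (x, y) ∈ Q.graph ↔ ∀ u v, (u, v) ∈ Q.graph → inner ℂ v x = inner ℂ u y := by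
  have h := LinearPMap.adjoint_graph_eq_graph_adjoint hQ.dense_domain
  rw [LinearPMap.isSelfAdjoint_def.1 hQ] at h
  nth_rw 1 [h]
  rw [Submodule.mem_adjoint_iff]
  simp only [sub_eq_zero]

theorem inner_graph_comm [CompleteSpace E] {Q : E →ₗ.[ℂ] E} (hQ : IsSelfAdjoint Q)
    {x y u v : E} (h : (x, y) ∈ Q.graph) (h' : (u, v) ∈ Q.graph) :
    inner ℂ v x = inner ℂ u y :=
  (mem_graph_iff_of_isSelfAdjoint hQ).1 h u v h'

/-- The cross term vanishes because `⟨Qx, x⟩` is real. -/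
theorem norm_sq_add_smul_of_mem_graph [CompleteSpace E] {Q : E →ₗ.[ℂ] E} (hQ : IsSelfAdjoint Q)
    (c : ℝ) {x y : E} (h : (x, y) ∈ Q.graph) :
    ‖y + (Complex.I * c) • x‖ ^ 2 = ‖y‖ ^ 2 + c ^ 2 * ‖x‖ ^ 2 := by
  have hs : (inner ℂ y x).im = 0 := by
    have := inner_graph_comm hQ h h
    rw [← inner_conj_symm] at this
    have := congrArg Complex.im this
    rw [← inner_conj_symm] 
    simp only [Complex.conj_im] at this ⊢
    linarith
  rw [@norm_add_sq ℂ]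
  simp [inner_smul_right, norm_smul, mul_pow, hs]

/-- The operator `(x, Q x) ↦ (Q + i c) x` on the graph of `Q`. -/
noncomputable def graphShift (Q : E →ₗ.[ℂ] E) (c : ℝ) : Q.graph →L[ℂ] E :=
  (ContinuousLinearMap.snd ℂ E E + (Complex.I * c) • ContinuousLinearMap.fst ℂ E E).comp
    Q.graph.subtypeL

theorem graphShift_apply (Q : E →ₗ.[ℂ] E) (c : ℝ) (p : Q.graph) :
    graphShift Q c p = p.1.2 + (Complex.I * c) • p.1.1 := rfl

theorem antilipschitz_graphShift [CompleteSpace E] {Q : E →ₗ.[ℂ] E} (hQ : IsSelfAdjoint Q)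
    {c : ℝ} (hc : c ≠ 0) : ∃ K, AntilipschitzWith K (graphShift Q c) := by
  refine ⟨⟨1 + |c|⁻¹, by positivity⟩, (graphShift Q c).antilipschitz_of_bound fun p => ?_⟩
  have h := norm_sq_add_smul_of_mem_graph hQ c p.2
  rw [← graphShift_apply] at h
  set N := ‖graphShift Q c p‖
  have hN : 0 ≤ N := norm_nonneg _
  have h1 : ‖p.1.2‖ ≤ N := by
    refine (abs_le_of_sq_le_sq' ?_ hN).2
    nlinarith [mul_nonneg (sq_nonneg c) (sq_nonneg ‖p.1.1‖)]
  have h2 : |c| * ‖p.1.1‖ ≤ N := by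
    refine (abs_le_of_sq_le_sq' ?_ hN).2
    rw [mul_pow, sq_abs]
    nlinarith [sq_nonneg ‖p.1.2‖]
  have h3 : ‖p.1.1‖ ≤ |c|⁻¹ * N := by
    rwa [inv_mul_eq_div, le_div_iff₀' (abs_pos.2 hc)]
  have h4 : 0 ≤ |c|⁻¹ * N := by positivity
  change max ‖p.1.1‖ ‖p.1.2‖ ≤ (1 + |c|⁻¹) * N
  refine max_le ?_ ?_ <;> nlinarith

/-- The lower bound on the complete graph gives injectivity and closed range. A vector `z`
orthogonal to the range satisfies `Qz = icz`, and the norm identity for `Q - ic` forces `z = 0`. -/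
theorem bijective_graphShift [CompleteSpace E] {Q : E →ₗ.[ℂ] E} (hQ : IsSelfAdjoint Q)
    {c : ℝ} (hc : c ≠ 0) : Function.Bijective (graphShift Q c) := by
  obtain ⟨K, hK⟩ := antilipschitz_graphShift hQ hc
  refine ⟨hK.injective, ?_⟩
  have : CompleteSpace Q.graph := hQ.isClosed.completeSpace_coe
  have hcl : IsClosed ((graphShift Q c).range : Set E) := by
    rw [LinearMap.coe_range]
    exact hK.isClosed_range (graphShift Q c).uniformContinuous
  change Function.Surjective (graphShift Q c).toLinearMap
  rw [← LinearMap.range_eq_top, ← hcl.submodule_topologicalClosure_eq,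
    Submodule.topologicalClosure_eq_top_iff, Submodule.eq_bot_iff]
  intro z hz
  have hz' : (z, (Complex.I * c) • z) ∈ Q.graph := by
    rw [mem_graph_iff_of_isSelfAdjoint hQ]
    intro u v huv
    have := (Submodule.mem_orthogonal _ _).1 hz _ ⟨⟨(u, v), huv⟩, rfl⟩
    change inner ℂ (graphShift Q c ⟨(u, v), huv⟩) z = 0 at this
    rw [graphShift_apply, inner_add_left, inner_smul_left] at this
    rw [inner_smul_right, ← sub_eq_zero, ← this]
    simp only [map_mul, Complex.conj_I, Complex.conj_ofReal]
    ring
  have h := norm_sq_add_smul_of_mem_graph hQ (-c) hz'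
  have h0 : (Complex.I * c) • z + (Complex.I * ((-c : ℝ) : ℂ)) • z = 0 := by
    rw [← add_smul]; simp
  rw [h0, norm_smul] at h
  have hc2 : 0 < c ^ 2 := by positivity
  simp only [norm_zero, norm_mul, Complex.norm_I, Complex.norm_real, mul_pow, one_mul, neg_sq,
    Real.norm_eq_abs, sq_abs] at h
  have : c ^ 2 * ‖z‖ ^ 2 = 0 := by
    nlinarith
  simpa [hc] using this

section Resolvent

variable [CompleteSpace E] {Q : E →ₗ.[ℂ] E}

/-- The resolvent `(Q + i c)⁻¹` of a selfadjoint operator, for real `c ≠ 0`. -/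
noncomputable def resolventI (hQ : IsSelfAdjoint Q) (c : ℝ) (hc : c ≠ 0) : E →L[ℂ] E :=
  haveI : CompleteSpace Q.graph := hQ.isClosed.completeSpace_coe
  ((ContinuousLinearMap.fst ℂ E E).comp Q.graph.subtypeL).comp
    (ContinuousLinearEquiv.ofBijective (graphShift Q c)
      (LinearMap.ker_eq_bot.2 (bijective_graphShift hQ hc).1)
      (LinearMap.range_eq_top.2 (bijective_graphShift hQ hc).2)).symm.toContinuousLinearMap

variable (hQ : IsSelfAdjoint Q) {c : ℝ} (hc : c ≠ 0)

theorem resolventI_mem_graph (ξ : E) :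
    (resolventI hQ c hc ξ, ξ - (Complex.I * c) • resolventI hQ c hc ξ) ∈ Q.graph := by
  have : CompleteSpace Q.graph := hQ.isClosed.completeSpace_coe
  set e := ContinuousLinearEquiv.ofBijective (graphShift Q c)
      (LinearMap.ker_eq_bot.2 (bijective_graphShift hQ hc).1)
      (LinearMap.range_eq_top.2 (bijective_graphShift hQ hc).2) with he
  have h1 : graphShift Q c (e.symm ξ) = ξ := e.apply_symm_apply ξ
  have h2 : resolventI hQ c hc ξ = (e.symm ξ).1.1 := rfl
  rw [graphShift_apply] at h1
  rw [h2]
  nth_rw 2 [← h1]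
  rw [add_sub_cancel_right]
  exact (e.symm ξ).2

theorem resolventI_of_mem_graph {x y : E} (h : (x, y) ∈ Q.graph) :
    resolventI hQ c hc (y + (Complex.I * c) • x) = x := by
  have : CompleteSpace Q.graph := hQ.isClosed.completeSpace_coe
  have h1 := resolventI_mem_graph hQ hc (y + (Complex.I * c) • x)
  have := (bijective_graphShift hQ hc).1 (a₁ := ⟨_, h1⟩) (a₂ := ⟨_, h⟩) (by
    simp [graphShift_apply])
  exact congrArg (fun p : Q.graph => p.1.1) this

theorem norm_resolventI_le (ξ : E) : ‖resolventI hQ c hc ξ‖ ≤ |c|⁻¹ * ‖ξ‖ := by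
  have h := norm_sq_add_smul_of_mem_graph hQ c (resolventI_mem_graph hQ hc ξ)
  rw [sub_add_cancel] at h
  rw [inv_mul_eq_div, le_div_iff₀' (abs_pos.2 hc)]
  refine (abs_le_of_sq_le_sq' ?_ (norm_nonneg _)).2
  rw [mul_pow, sq_abs, h]
  nlinarith [sq_nonneg ‖ξ - (Complex.I * c) • resolventI hQ c hc ξ‖]

theorem inner_resolventI_left (hc' : -c ≠ 0) (ξ η : E) :
    inner ℂ (resolventI hQ c hc ξ) η = inner ℂ ξ (resolventI hQ (-c) hc' η) := by
  have h1 := resolventI_mem_graph hQ hc ξ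
  have h2 := resolventI_mem_graph hQ hc' η
  have := inner_graph_comm hQ h2 h1
  simp only [inner_sub_left, inner_sub_right, inner_smul_left, inner_smul_right] at this
  simp at this
  exact this.symm

theorem denseRange_resolventI : DenseRange (resolventI hQ c hc) := by
  refine hQ.dense_domain.mono fun x hx => ?_
  exact ⟨_, resolventI_of_mem_graph hQ hc (Q.mem_graph ⟨x, hx⟩)⟩

/-- A bounded operator commuting with one resolvent of `Q` commutes with `Q` on `D(Q)`. -/
theorem map_mem_graph_of_commute {B : E →L[ℂ] E} (h : Commute B (resolventI hQ c hc)) {x y : E}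
    (hxy : (x, y) ∈ Q.graph) : (B x, B y) ∈ Q.graph := by
  have h1 := resolventI_of_mem_graph hQ hc hxy
  have h2 := resolventI_mem_graph hQ hc (B (y + (Complex.I * c) • x))
  have h3 : resolventI hQ c hc (B (y + (Complex.I * c) • x)) = B x := by
    rw [← mul_apply_eq_comp, ← h.eq, mul_apply_eq_comp, h1]
  rw [h3, map_add, map_smul, add_sub_cancel_right] at h2
  exact h2

/-- The resolvent `(1 + Q²)⁻¹`. -/
noncomputable def resolventSq (hQ : IsSelfAdjoint Q) : E →L[ℂ] E :=
  resolventI hQ (-1) (by norm_num) * resolventI hQ 1 one_ne_zero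

/-- This is the factorization `1 + Q² = (Q + i)(Q - i)` including domains; it replaces the unbounded
`Q²` by a bounded operator. -/
theorem mem_graph_square_iff {x z : E} :
    (x, z) ∈ (square Q).graph ↔ resolventSq hQ (x + z) = x := by
  rw [mem_graph_square]
  constructor
  · rintro ⟨y, hxy, hyz⟩
    have h1 : (y - Complex.I • x, z - Complex.I • y) ∈ Q.graph :=
      Q.graph.sub_mem hyz (Q.graph.smul_mem Complex.I hxy)
    have h2 := resolventI_of_mem_graph hQ (one_ne_zero (α := ℝ)) h1
    have h3 := resolventI_of_mem_graph hQ (c := -1) (by norm_num) hxy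
    have e1 : z - Complex.I • y + (Complex.I * ((1 : ℝ) : ℂ)) • (y - Complex.I • x) = x + z := by
      simp only [Complex.ofReal_one, mul_one, smul_sub, smul_smul, Complex.I_mul_I]
      module
    have e2 : y + (Complex.I * ((-1 : ℝ) : ℂ)) • x = y - Complex.I • x := by
      simp only [Complex.ofReal_neg, Complex.ofReal_one]
      module
    rw [e1] at h2
    rw [e2] at h3
    rw [resolventSq, mul_apply_eq_comp, h2, h3]
  · intro h
    rw [resolventSq, mul_apply_eq_comp] at h
    have h1 := resolventI_mem_graph hQ (one_ne_zero (α := ℝ)) (x + z)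
    have h2 := resolventI_mem_graph hQ (c := -1) (by norm_num)
      (resolventI hQ 1 one_ne_zero (x + z))
    set w := resolventI hQ 1 one_ne_zero (x + z)
    rw [h] at h2
    refine ⟨_, h2, ?_⟩
    have h3 := Q.graph.add_mem h1 (Q.graph.smul_mem Complex.I h2)
    convert h3 using 1
    simp only [Complex.ofReal_one, Complex.ofReal_neg, mul_one, smul_sub, smul_smul,
      Prod.mk_add_mk, Prod.smul_mk, Prod.mk.injEq]
    constructor
    · module
    · have : Complex.I * (Complex.I * -1) = 1 := by simp
      rw [this]
      module

theorem resolventSq_mem_graph (η : E) :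
    (resolventSq hQ η, η - resolventSq hQ η) ∈ (square Q).graph := by
  rw [mem_graph_square_iff hQ, add_sub_cancel]

theorem isSelfAdjoint_resolventSq : IsSelfAdjoint (resolventSq hQ) := by
  rw [ContinuousLinearMap.isSelfAdjoint_iff_isSymmetric]
  intro x y
  simp only [resolventSq, ContinuousLinearMap.coe_coe, mul_apply_eq_comp]
  rw [inner_resolventI_left hQ (c := -1) _ (by norm_num),
    inner_resolventI_left hQ (c := 1) _ (by norm_num)]
  simp only [neg_neg]

theorem denseRange_resolventSq : DenseRange (resolventSq hQ) :=
  DenseRange.comp (g := resolventI hQ (-1) (by norm_num)) (f := resolventI hQ 1 one_ne_zero)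
    (denseRange_resolventI hQ _) (denseRange_resolventI hQ _) (resolventI hQ (-1) _).continuous

end Resolvent

end SuperDer

/-! ### Stone's theorem for `Q²` through the functional calculus of `(1 + Q²)⁻¹`. -/

namespace SuperDer

variable {E : Type*} [NormedAddCommGroup E] [InnerProductSpace ℂ E]

theorem norm_exp_I_mul_sub_one_sub_le (s : ℝ) :
    ‖Complex.exp (Complex.I * s) - 1 - Complex.I * s‖ ≤ 2 * s ^ 2 := by
  rcases le_total |s| 1 with h | h
  · have h1 : ‖Complex.I * (s : ℂ)‖ = |s| := by simp
    have := Complex.norm_exp_sub_one_sub_id_le (x := Complex.I * s) (h1.trans_le h)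
    rw [h1, sq_abs] at this
    nlinarith [sq_nonneg s]
  · refine (norm_sub_le _ _).trans ?_
    have h1 := Real.norm_exp_I_mul_ofReal_sub_one_le (x := s)
    rw [Real.norm_eq_abs] at h1
    have h2 : ‖Complex.I * (s : ℂ)‖ = |s| := by simp
    rw [h2]
    nlinarith [sq_abs s]

/-- The function `x ↦ x e^{it(1/x - 1)}` (of the real part of `z`), with value `0` at `0`. -/
noncomputable def dampedPhase (t : ℝ) (z : ℂ) : ℂ :=
  (z.re : ℂ) * Complex.exp (Complex.I * ((t * (z.re⁻¹ - 1) : ℝ) : ℂ))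

theorem norm_dampedPhase (t : ℝ) (z : ℂ) : ‖dampedPhase t z‖ = |z.re| := by
  rw [dampedPhase, norm_mul, mul_comm Complex.I, Complex.norm_exp_ofReal_mul_I, mul_one,
    Complex.norm_real, Real.norm_eq_abs]

-- The phase oscillates wildly near `0`, but the modulus is `|x|`, so the factor `x` restores
-- continuity there.
@[fun_prop]
theorem continuous_dampedPhase (t : ℝ) : Continuous (dampedPhase t) := by
  rw [continuous_iff_continuousAt]
  intro z
  by_cases hz : z.re = 0
  · have h0 : dampedPhase t z = 0 := by rw [← norm_eq_zero, norm_dampedPhase, hz, abs_zero]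
    rw [ContinuousAt, h0, tendsto_zero_iff_norm_tendsto_zero]
    simp only [norm_dampedPhase]
    have : Continuous fun w : ℂ => |w.re| := by fun_prop
    simpa [hz] using this.tendsto z
  · unfold dampedPhase
    have : ContinuousAt (fun w : ℂ => w.re⁻¹) z :=
      Complex.continuous_re.continuousAt.inv₀ hz
    fun_prop

section

variable [CompleteSpace E] {R : E →L[ℂ] E} (hR : IsSelfAdjoint R)

-- Group law for `e^{it(1/R - 1)}R`: each factor carries its own `R`, so one `R` remains on the
-- right.
include hR in
theorem cfc_dampedPhase_mul (s t : ℝ) :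
    cfc (dampedPhase s) R * cfc (dampedPhase t) R = cfc (dampedPhase (s + t)) R * R := by
  have : IsStarNormal R := hR.isStarNormal
  nth_rw 4 [← cfc_id' ℂ R]
  rw [← cfc_mul _ _ R, ← cfc_mul _ _ R]
  refine cfc_congr fun z hz => ?_
  obtain ⟨x, rfl⟩ : ∃ x : ℝ, z = x := ⟨_, hR.mem_spectrum_eq_re hz⟩
  have e : Complex.exp (Complex.I * (((s + t) * (x⁻¹ - 1) : ℝ) : ℂ)) =
      Complex.exp (Complex.I * ((s * (x⁻¹ - 1) : ℝ) : ℂ)) *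
      Complex.exp (Complex.I * ((t * (x⁻¹ - 1) : ℝ) : ℂ)) := by
    rw [← Complex.exp_add]; congr 1; push_cast; ring
  simp only [dampedPhase, Complex.ofReal_re, e]
  ring

include hR in
theorem cfc_dampedPhase_zero : cfc (dampedPhase 0) R = R := by
  have : IsStarNormal R := hR.isStarNormal
  nth_rw 2 [← cfc_id' ℂ R]
  refine cfc_congr fun z hz => ?_
  have hz := hR.mem_spectrum_eq_re hz
  simp only [dampedPhase]
  rw [← hz]
  simp

include hR in
theorem norm_cfc_dampedPhase_apply (t : ℝ) (ψ : E) : ‖cfc (dampedPhase t) R ψ‖ = ‖R ψ‖ := by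
  have : IsStarNormal R := hR.isStarNormal
  have h : star (cfc (dampedPhase t) R) * cfc (dampedPhase t) R = star R * R := by
    rw [hR.star_eq, ← cfc_star]
    nth_rw 3 4 [← cfc_id' ℂ R]
    rw [← cfc_mul _ _ R, ← cfc_mul _ _ R]
    refine cfc_congr fun z hz => ?_
    have hz := hR.mem_spectrum_eq_re hz
    have h1 : star (dampedPhase t z) * dampedPhase t z = ((‖dampedPhase t z‖ ^ 2 : ℝ) : ℂ) := by
      rw [Complex.star_def, Complex.conj_mul']
      norm_cast
    rw [h1, norm_dampedPhase, sq_abs]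
    nth_rw 2 3 [hz]
    push_cast
    ring
  have key : ∀ B : E →L[ℂ] E, ‖B ψ‖ ^ 2 = RCLike.re (inner ℂ ((star B * B) ψ) ψ) := fun B => by
    rw [ContinuousLinearMap.star_eq_adjoint, mul_apply_eq_comp,
      ContinuousLinearMap.adjoint_inner_left, inner_self_eq_norm_sq]
  rw [← sq_eq_sq₀ (norm_nonneg _) (norm_nonneg _), key, key, h]

-- One factor `x` turns `|t(1/x - 1)|` into `|t||1 - x|`; two factors absorb the quadratic Taylor
-- remainder. On the spectrum `|1 - x| ≤ 1 + |C|`, and `2(1 + |C|)²` serves both bounds.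
include hR in
theorem exists_norm_cfc_dampedPhase_sub_le :
    ∃ C, 0 ≤ C ∧ ∀ t : ℝ, ‖cfc (dampedPhase t) R - R‖ ≤ C * |t| ∧
      ‖cfc (dampedPhase t) R * R - R * R - (Complex.I * t) • ((1 - R) * R)‖ ≤ C * t ^ 2 := by
  have : IsStarNormal R := hR.isStarNormal
  obtain ⟨C, hC⟩ := (spectrum.isCompact (𝕜 := ℂ) R).isBounded.exists_norm_le
  have hC' : ∀ z ∈ spectrum ℂ R, |1 - z.re| ≤ 1 + |C| := fun z hz => by
    have := (Complex.abs_re_le_norm z).trans ((hC z hz).trans (le_abs_self C))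
    have h2 := abs_sub 1 z.re
    rw [abs_one] at h2
    linarith
  have hD : (1 + |C|) ≤ 2 * (1 + |C|) ^ 2 := by nlinarith [abs_nonneg C]
  refine ⟨2 * (1 + |C|) ^ 2, by positivity, fun t => ⟨?_, ?_⟩⟩
  · have e : cfc (dampedPhase t) R - R = cfc (fun z => dampedPhase t z - z) R := by
      rw [cfc_sub _ _ R, cfc_id' ℂ R]
    rw [e]
    refine norm_cfc_le (by positivity) fun z hz => ?_
    have hz' := hR.mem_spectrum_eq_re hz
    have h1 : dampedPhase t z - z = (z.re : ℂ) *
        (Complex.exp (Complex.I * ((t * (z.re⁻¹ - 1) : ℝ) : ℂ)) - 1) := by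
      rw [mul_sub, mul_one, ← dampedPhase, ← hz']
    have h2 := Real.norm_exp_I_mul_ofReal_sub_one_le (x := t * (z.re⁻¹ - 1))
    have h3 : |z.re| * |t * (z.re⁻¹ - 1)| ≤ |1 - z.re| * |t| := by
      rw [← abs_mul, ← abs_mul]
      rcases eq_or_ne z.re 0 with h | h
      · rw [h]; simp
      · apply le_of_eq; congr 1; field_simp
    rw [h1, norm_mul, Complex.norm_real, Real.norm_eq_abs]
    rw [Real.norm_eq_abs] at h2
    calc _ ≤ |z.re| * |t * (z.re⁻¹ - 1)| := by gcongr
      _ ≤ _ := h3.trans (by gcongr; exact (hC' z hz).trans hD)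
  · have e : cfc (dampedPhase t) R * R - R * R - (Complex.I * t) • ((1 - R) * R) =
        cfc (fun z => dampedPhase t z * z - z * z - (Complex.I * t) * ((1 - z) * z)) R := by
      rw [cfc_sub _ _ R, cfc_sub _ _ R, cfc_const_mul _ _ R, cfc_mul _ _ R, cfc_mul _ _ R,
        cfc_mul _ _ R, cfc_sub _ _ R, cfc_const_one ℂ R, cfc_id' ℂ R]
    rw [e]
    refine norm_cfc_le (by positivity) fun z hz => ?_
    have hz' := hR.mem_spectrum_eq_re hz
    rcases eq_or_ne z.re 0 with h | h
    · rw [h] at hz'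
      rw [hz']
      simp only [Complex.ofReal_zero, mul_zero, sub_zero, norm_zero]
      positivity
    · have h1 : dampedPhase t z * z - z * z - (Complex.I * t) * ((1 - z) * z) = (z.re : ℂ) ^ 2 *
          (Complex.exp (Complex.I * ((t * (z.re⁻¹ - 1) : ℝ) : ℂ)) - 1 -
            Complex.I * ((t * (z.re⁻¹ - 1) : ℝ) : ℂ)) := by
        have h' : (z.re : ℂ) ≠ 0 := by exact_mod_cast h
        rw [dampedPhase]
        generalize Complex.exp _ = w
        have : z = (z.re : ℂ) := hz'
        generalize z.re = x at *
        subst this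
        push_cast
        field_simp
      have h2 := norm_exp_I_mul_sub_one_sub_le (t * (z.re⁻¹ - 1))
      rw [h1, norm_mul, norm_pow, Complex.norm_real, Real.norm_eq_abs, sq_abs]
      calc _ ≤ z.re ^ 2 * (2 * (t * (z.re⁻¹ - 1)) ^ 2) := by gcongr
        _ = 2 * |1 - z.re| ^ 2 * t ^ 2 := by rw [sq_abs]; field_simp
        _ ≤ _ := by gcongr; exact hC' z hz

/-- The operator `e^{it(1/R - 1)}`, for a selfadjoint operator `R` with dense range. -/
noncomputable def phaseOp (R : E →L[ℂ] E) (t : ℝ) : E →L[ℂ] E :=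
  (cfc (dampedPhase t) R).toLinearMap.extendOfNorm R.toLinearMap

variable (hd : DenseRange R)

include hR hd

theorem phaseOp_apply (t : ℝ) (ψ : E) : phaseOp R t (R ψ) = cfc (dampedPhase t) R ψ :=
  LinearMap.extendOfNorm_eq (f := (cfc (dampedPhase t) R).toLinearMap) (e := R.toLinearMap) hd
    ⟨1, fun x => by rw [one_mul]; exact (norm_cfc_dampedPhase_apply hR t x).le⟩ ψ

theorem norm_phaseOp_apply (t : ℝ) (ψ : E) : ‖phaseOp R t ψ‖ = ‖ψ‖ := by
  refine hd.induction_on (p := fun ψ => ‖phaseOp R t ψ‖ = ‖ψ‖) ψ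
    (isClosed_eq (by fun_prop) (by fun_prop)) fun x => ?_
  rw [phaseOp_apply hR hd, norm_cfc_dampedPhase_apply hR]

theorem phaseOp_zero : phaseOp R 0 = 1 := by
  ext ψ
  refine hd.induction_on (p := fun ψ => phaseOp R 0 ψ = ψ) ψ
    (isClosed_eq (by fun_prop) (by fun_prop)) fun x => ?_
  rw [phaseOp_apply hR hd, cfc_dampedPhase_zero hR]

theorem phaseOp_add (s t : ℝ) : phaseOp R (s + t) = phaseOp R s * phaseOp R t := by
  have hc : ∀ t, Commute (cfc (dampedPhase t) R) R := fun t =>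
    (Commute.refl R).cfc (hR.star_eq.symm ▸ Commute.refl R) _
  have hd2 : DenseRange (R ∘ R) := hd.comp hd R.continuous
  ext ψ
  refine hd2.induction_on (p := fun ψ => phaseOp R (s + t) ψ = (phaseOp R s * phaseOp R t) ψ) ψ
    (isClosed_eq (by fun_prop) (by fun_prop)) fun x => ?_
  rw [Function.comp_apply, mul_apply_eq_comp, phaseOp_apply hR hd, phaseOp_apply hR hd,
    ← mul_apply_eq_comp, ← mul_apply_eq_comp, ← cfc_dampedPhase_mul hR, mul_apply_eq_comp, mul_apply_eq_comp,
    ← phaseOp_apply hR hd s, ← mul_apply_eq_comp R, ← (hc t).eq, mul_apply_eq_comp]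

/-- The quadratic error bound is available only on the range of `R²`. Approximating `η` by `Rζ`
leaves a term that is small relative to `|t|`, by the first-order bound. -/
theorem hasDerivAt_phaseOp (η : E) :
    HasDerivAt (fun t => phaseOp R t (R η)) (Complex.I • (η - R η)) 0 := by
  obtain ⟨C, hC0, hC⟩ := exists_norm_cfc_dampedPhase_sub_le hR
  rw [hasDerivAt_iff_isLittleO, Asymptotics.isLittleO_iff]
  intro ε hε
  set K := C + ‖(1 - R : E →L[ℂ] E)‖ with hK
  have hK0 : 0 ≤ K := by positivity
  -- This precision bounds the approximation error by `|t| ε / 2`; the `+ 1` only avoids division by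
  -- zero.
  obtain ⟨ζ, hζ⟩ := hd.exists_dist_lt η (ε := ε / 2 / (K + 1)) (by positivity)
  rw [dist_eq_norm] at hζ
  have hev : ∀ᶠ t : ℝ in nhds 0, C * |t| * ‖ζ‖ < ε / 2 := by
    have : Continuous fun t : ℝ => C * |t| * ‖ζ‖ := by fun_prop
    refine (this.tendsto 0).eventually_lt_const ?_
    simpa using half_pos hε
  filter_upwards [hev] with t ht
  rw [phaseOp_apply hR hd, phaseOp_apply hR hd, cfc_dampedPhase_zero hR, sub_zero]
  have e : cfc (dampedPhase t) R η - R η - t • Complex.I • (η - R η) =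
      (cfc (dampedPhase t) R - R) (η - R ζ) - (Complex.I * t) • (1 - R) (η - R ζ) +
      (cfc (dampedPhase t) R * R - R * R - (Complex.I * t) • ((1 - R) * R)) ζ := by
    have : t • Complex.I • (η - R η) = (Complex.I * t) • (η - R η) := by
      rw [mul_comm, mul_smul, Complex.coe_smul]
    rw [this]
    simp only [map_sub, sub_apply, one_apply_eq_self, mul_apply_eq_comp, smul_apply, smul_sub]
    abel
  rw [e, Real.norm_eq_abs]
  have h1 : ‖(cfc (dampedPhase t) R - R) (η - R ζ)‖ ≤ C * |t| * ‖η - R ζ‖ :=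
    ContinuousLinearMap.le_of_opNorm_le _ (hC t).1 _
  have h2 : ‖(Complex.I * t) • (1 - R) (η - R ζ)‖ ≤ |t| * (‖(1 - R : E →L[ℂ] E)‖ * ‖η - R ζ‖) := by
    rw [norm_smul]
    simp only [norm_mul, Complex.norm_I, one_mul, Complex.norm_real, Real.norm_eq_abs]
    gcongr
    exact ContinuousLinearMap.le_opNorm _ _
  have h3 : ‖(cfc (dampedPhase t) R * R - R * R - (Complex.I * t) • ((1 - R) * R)) ζ‖ ≤
      C * t ^ 2 * ‖ζ‖ := ContinuousLinearMap.le_of_opNorm_le _ (hC t).2 _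
  have h4 : K * ‖η - R ζ‖ ≤ ε / 2 := by
    calc K * ‖η - R ζ‖ ≤ (K + 1) * (ε / 2 / (K + 1)) := by gcongr; linarith
      _ = ε / 2 := by field_simp
  calc _ ≤ C * |t| * ‖η - R ζ‖ + |t| * (‖(1 - R : E →L[ℂ] E)‖ * ‖η - R ζ‖) + C * t ^ 2 * ‖ζ‖ :=
        (norm_add_le _ _).trans (add_le_add ((norm_sub_le _ _).trans (add_le_add h1 h2)) h3)
    _ = |t| * (K * ‖η - R ζ‖) + |t| * (C * |t| * ‖ζ‖) := by rw [hK, ← sq_abs]; ring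
    _ ≤ |t| * (ε / 2) + |t| * (ε / 2) := by gcongr
    _ = ε * |t| := by ring

/-- The unitary group `t ↦ e^{it(1/R - 1)}`. -/
noncomputable def phaseGroup : UnitaryGroup E where
  U := phaseOp R
  zero := phaseOp_zero hR hd
  add := phaseOp_add hR hd
  norm_apply := norm_phaseOp_apply hR hd
  continuous_apply := by
    have h0 : ∀ ψ, ContinuousAt (fun t => phaseOp R t ψ) 0 := by
      intro ψ
      rw [Metric.continuousAt_iff']
      intro ε hε
      obtain ⟨η, hη⟩ := hd.exists_dist_lt ψ (ε := ε / 3) (by positivity)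
      have h := (Metric.continuousAt_iff'.1 (hasDerivAt_phaseOp hR hd η).continuousAt) (ε / 3)
        (by positivity)
      filter_upwards [h] with t ht
      have key : ∀ s, dist (phaseOp R s ψ) (phaseOp R s (R η)) < ε / 3 := fun s => by
        rwa [dist_eq_norm, ← map_sub, norm_phaseOp_apply hR hd, ← dist_eq_norm]
      have := dist_triangle4 (phaseOp R t ψ) (phaseOp R t (R η)) (phaseOp R 0 (R η))
        (phaseOp R 0 ψ)
      have k1 := key t
      have k2 := key 0
      rw [dist_comm] at k2
      linarith
    intro ψ
    rw [continuous_iff_continuousAt]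
    intro t
    have h1 : ContinuousAt (fun s => phaseOp R (s - t) ψ) t :=
      ContinuousAt.comp (g := fun s => phaseOp R s ψ) (f := fun s => s - t)
        (by rw [sub_self]; exact h0 ψ) (by fun_prop)
    have h2 : (fun s => phaseOp R s ψ) = fun s => phaseOp R t (phaseOp R (s - t) ψ) := by
      funext s
      rw [← mul_apply_eq_comp, ← phaseOp_add hR hd, add_sub_cancel]
    rw [h2]
    exact (phaseOp R t).continuous.continuousAt.comp h1

end

namespace UnitaryGroup

variable (V : UnitaryGroup E)

theorem inner_map_map (t : ℝ) (φ ψ : E) : inner ℂ (V.U t φ) (V.U t ψ) = inner ℂ φ ψ :=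
  LinearIsometry.inner_map_map ⟨(V.U t).toLinearMap, V.norm_apply t⟩ φ ψ

theorem map_neg_map (t : ℝ) (ψ : E) : V.U t (V.U (-t) ψ) = ψ := by
  rw [← mul_apply_eq_comp, ← V.add, add_neg_cancel, V.zero, one_apply_eq_self]

theorem neg_map_map (t : ℝ) (ψ : E) : V.U (-t) (V.U t ψ) = ψ := by
  rw [← mul_apply_eq_comp, ← V.add, neg_add_cancel, V.zero, one_apply_eq_self]

theorem inner_map_right (t : ℝ) (φ ψ : E) : inner ℂ φ (V.U t ψ) = inner ℂ (V.U (-t) φ) ψ := by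
  rw [← V.inner_map_map t (V.U (-t) φ), V.map_neg_map]

end UnitaryGroup

variable [CompleteSpace E] {Q : E →ₗ.[ℂ] E}

theorem exists_hasGenerator_square (hQ : IsSelfAdjoint Q) :
    ∃ V : UnitaryGroup E, V.HasGenerator (square Q) := by
  set R := resolventSq hQ with hRdef
  have hR : IsSelfAdjoint R := isSelfAdjoint_resolventSq hQ
  have hd : DenseRange R := denseRange_resolventSq hQ
  have hder : ∀ η, HasDerivAt (fun t => (phaseGroup hR hd).U t (R η)) (Complex.I • (η - R η)) 0 :=
    hasDerivAt_phaseOp hR hd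
  generalize phaseGroup hR hd = V at hder
  refine ⟨V, fun ψ φ => ?_⟩
  rw [mem_graph_square_iff hQ, ← hRdef]
  constructor
  · intro h
    have := hder (ψ + φ)
    rwa [h, add_sub_cancel_left] at this
  · intro h
    -- For the converse, differentiate `⟨V(t)Rη, ψ⟩ = ⟨Rη, V(-t)ψ⟩` at `0` in both forms; symmetry
    -- of `R` then gives `R(ψ + φ) = ψ`.
    have hsym : ∀ x y, inner ℂ (R x) y = inner ℂ x (R y) := fun x y =>
      (ContinuousLinearMap.isSelfAdjoint_iff_isSymmetric.1 hR) x y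
    refine ext_inner_left ℂ fun η => ?_
    have h1 : HasDerivAt (fun t => inner ℂ (V.U t (R η)) ψ)
        (inner ℂ (Complex.I • (η - R η)) ψ) 0 := by
      simpa only [inner_zero_right, zero_add] using (hder η).inner ℂ (hasDerivAt_const (0 : ℝ) ψ)
    have h2 : HasDerivAt (fun t => inner ℂ (R η) (V.U (-t) ψ))
        (inner ℂ (R η) (-(Complex.I • φ))) 0 := by
      have h' : HasDerivAt (fun t => V.U (-t) ψ) (-(Complex.I • φ)) 0 := by
        have := HasDerivAt.scomp (h := fun t : ℝ => -t) (h' := -1) (0 : ℝ) 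
          (by simpa using h) (hasDerivAt_neg 0)
        simpa [Function.comp_def] using this
      simpa using (hasDerivAt_const (0 : ℝ) (R η)).inner ℂ h'
    have h3 : (fun t => inner ℂ (V.U t (R η)) ψ) = fun t => inner ℂ (R η) (V.U (-t) ψ) := by
      funext t
      rw [V.inner_map_right, neg_neg]
    rw [h3] at h1
    have h4 := h1.unique h2
    rw [inner_neg_right, inner_smul_left, inner_smul_right, Complex.conj_I, neg_mul, neg_inj] at h4
    have h5 := mul_left_cancel₀ Complex.I_ne_zero h4
    rw [inner_sub_left, hsym, hsym] at h5
    rw [map_add, inner_add_right, ← h5]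
    ring

theorem hasGenerator_expI (hQ : IsSelfAdjoint Q) :
    (expI (square Q)).HasGenerator (square Q) := by
  have h := exists_hasGenerator_square hQ
  rw [expI, dif_pos h]
  exact h.choose_spec

end SuperDer

/-! ### Invariance properties of the unitary group. -/

namespace SuperDer

variable {E : Type*} [NormedAddCommGroup E] [InnerProductSpace ℂ E] [CompleteSpace E]
  {Q : E →ₗ.[ℂ] E}

theorem inner_graph_square_comm (hQ : IsSelfAdjoint Q) {x z u w : E}
    (h : (x, z) ∈ (square Q).graph) (h' : (u, w) ∈ (square Q).graph) :
    inner ℂ w x = inner ℂ u z := by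
  obtain ⟨y, h1, h2⟩ := mem_graph_square.1 h
  obtain ⟨v, h1', h2'⟩ := mem_graph_square.1 h'
  rw [inner_graph_comm hQ h1 h2', inner_graph_comm hQ h2 h1']

theorem denseRange_domain_square (hQ : IsSelfAdjoint Q) :
    DenseRange fun p : (square Q).graph => p.1.1 :=
  (denseRange_resolventSq hQ).mono fun x hx => by
    obtain ⟨η, rfl⟩ := hx
    exact ⟨⟨_, resolventSq_mem_graph hQ η⟩, rfl⟩

namespace UnitaryGroup

variable {V : UnitaryGroup E}

omit [CompleteSpace E] in
theorem HasGenerator.map_mem_graph {H : E →ₗ.[ℂ] E} (hV : V.HasGenerator H) {ψ φ : E}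
    (h : (ψ, φ) ∈ H.graph) (t : ℝ) : (V.U t ψ, V.U t φ) ∈ H.graph := by
  rw [hV]
  have h1 := ((V.U t).restrictScalars ℝ).hasFDerivAt.comp_hasDerivAt (0 : ℝ) ((hV _ _).1 h)
  have h2 : (fun s => V.U s (V.U t ψ)) = (V.U t).restrictScalars ℝ ∘ fun s => V.U s ψ := by
    funext s
    rw [← mul_apply_eq_comp, ← V.add, add_comm, V.add]
    rfl
  rw [h2, ← map_smul]
  exact h1

omit [CompleteSpace E] in
theorem HasGenerator.hasDerivAt {H : E →ₗ.[ℂ] E} (hV : V.HasGenerator H) {ψ φ : E}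
    (h : (ψ, φ) ∈ H.graph) (t : ℝ) :
    HasDerivAt (fun s => V.U s ψ) (Complex.I • V.U t φ) t := by
  have h1 := (hV _ _).1 (hV.map_mem_graph h t)
  rw [← sub_self t] at h1
  have h2 := h1.comp_sub_const t t
  refine h2.congr_of_eventuallyEq (Filter.Eventually.of_forall fun s => ?_)
  simp only
  rw [← mul_apply_eq_comp, ← V.add, sub_add_cancel]

omit [CompleteSpace E] in
theorem HasGenerator.hasDerivAt_inner {H : E →ₗ.[ℂ] E} (hV : V.HasGenerator H) {ψ ψ' φ φ' : E}
    (hψ : (ψ, ψ') ∈ H.graph) (hφ : (φ, φ') ∈ H.graph) (a : E →L[ℂ] E) (t : ℝ) :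
    HasDerivAt (fun s => inner ℂ (V.U (-s) φ) (a (V.U (-s) ψ)))
      (Complex.I * (inner ℂ (V.U (-t) φ') (a (V.U (-t) ψ)) -
        inner ℂ (V.U (-t) φ) (a (V.U (-t) ψ')))) t := by
  have key : ∀ {ψ ψ' : E}, (ψ, ψ') ∈ H.graph →
      HasDerivAt (fun s => V.U (-s) ψ) (-(Complex.I • V.U (-t) ψ')) t := fun h => by
    have := HasDerivAt.scomp (h := fun t : ℝ => -t) (h' := -1) t
      (hV.hasDerivAt h (-t)) (hasDerivAt_neg t)
    simpa [Function.comp_def] using this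
  have h1 := (a.restrictScalars ℝ).hasFDerivAt.comp_hasDerivAt t (key hψ)
  have h2 := (key hφ).inner ℂ h1
  refine h2.congr_deriv ?_
  simp only [Function.comp_apply, ContinuousLinearMap.coe_restrictScalars', map_neg, map_smul,
    inner_neg_right, inner_neg_left, inner_smul_left, inner_smul_right, Complex.conj_I]
  ring

/-- A bounded operator that commutes with `Q²` commutes with the unitary group of `Q²`. -/
theorem HasGenerator.map_comm (hQ : IsSelfAdjoint Q) (hV : V.HasGenerator (square Q))
    {B : E →L[ℂ] E} (hB : ∀ x z, (x, z) ∈ (square Q).graph → (B x, B z) ∈ (square Q).graph)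
    (t : ℝ) (ψ : E) : V.U t (B ψ) = B (V.U t ψ) := by
  have key : ∀ ψ, V.U t (B (V.U (-t) ψ)) = B ψ := by
    intro ψ
    refine (denseRange_domain_square hQ).induction_on (p := fun ψ => V.U t (B (V.U (-t) ψ)) = B ψ) ψ
      (isClosed_eq (by fun_prop) (by fun_prop)) fun ⟨⟨ψ, ψ'⟩, hψ⟩ => ?_
    refine Dense.eq_of_inner_right ℂ (denseRange_domain_square hQ) ?_
    rintro _ ⟨⟨⟨φ, φ'⟩, hφ⟩, rfl⟩
    simp only
    -- The derivative is a matrix element of `[Q², B]`, which vanishes, so the pairing keeps its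
    -- value at time `0`.
    have hd : ∀ s, HasDerivAt (fun s => inner ℂ (V.U (-s) φ) (B (V.U (-s) ψ))) 0 s := fun s => by
      refine (hV.hasDerivAt_inner hψ hφ B s).congr_deriv ?_
      rw [inner_graph_square_comm hQ (hB _ _ (hV.map_mem_graph hψ (-s)))
        (hV.map_mem_graph hφ (-s)), sub_self, mul_zero]
    have := is_const_of_deriv_eq_zero (fun s => (hd s).differentiableAt)
      (fun s => (hd s).deriv) t 0
    rw [V.inner_map_right, this]
    simp [V.zero]
  have := key (V.U t ψ)
  rwa [V.neg_map_map] at this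

/-- The resolvent of `Q` commutes with `Q²`, hence with the group; so the group commutes with the
resolvent, and thus with `Q`. -/
theorem HasGenerator.map_mem_graph_sqrt (hQ : IsSelfAdjoint Q) (hV : V.HasGenerator (square Q))
    {x y : E} (h : (x, y) ∈ Q.graph) (t : ℝ) : (V.U t x, V.U t y) ∈ Q.graph := by
  refine map_mem_graph_of_commute hQ one_ne_zero (ContinuousLinearMap.ext fun ψ => ?_) h
  refine hV.map_comm hQ (fun x z hxz => ?_) t ψ
  obtain ⟨y, h1, h2⟩ := mem_graph_square.1 hxz
  exact mem_graph_square.2 ⟨_, map_mem_graph_of_commute hQ one_ne_zero (Commute.refl _) h1,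
    map_mem_graph_of_commute hQ one_ne_zero (Commute.refl _) h2⟩

end UnitaryGroup

/-! ### Oddness and the weak form of the superderivation. -/

section Odd

variable {Γ : E →L[ℂ] E} (hΓ : IsSelfAdjoint Γ) (hΓu : Γ ∈ unitary (E →L[ℂ] E))

include hΓ hΓu in
theorem grading_involutive (ψ : E) : Γ (Γ ψ) = ψ := by
  have := (Unitary.mem_iff.1 hΓu).1
  rw [hΓ.star_eq] at this
  exact congrArg (fun T : E →L[ℂ] E => T ψ) this

include hΓ in
theorem inner_grading_left (φ ψ : E) : inner ℂ (Γ φ) ψ = inner ℂ φ (Γ ψ) :=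
  (ContinuousLinearMap.isSelfAdjoint_iff_isSymmetric.1 hΓ) φ ψ

variable (hodd : IsOdd Γ Q)

include hΓ hΓu hodd in
theorem IsOdd.map_mem_graph {x y : E} (h : (x, y) ∈ Q.graph) : (Γ x, -Γ y) ∈ Q.graph := by
  obtain ⟨⟨x, hx⟩, rfl, rfl⟩ := (LinearPMap.mem_graph_iff _).1 h
  have h1 := (hodd.1 x).2 hx
  have h2 := congrArg Γ (hodd.2 ⟨x, hx⟩ h1)
  rw [grading_involutive hΓ hΓu, map_neg] at h2
  simp only
  rw [← h2]
  exact Q.mem_graph ⟨Γ x, h1⟩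

-- The two sign changes from `ΓQΓ = -Q` cancel in `Q²`.
include hΓ hΓu hodd in
theorem UnitaryGroup.HasGenerator.map_grading_comm {V : UnitaryGroup E} (hQ : IsSelfAdjoint Q)
    (hV : V.HasGenerator (square Q)) (t : ℝ) (ψ : E) : V.U t (Γ ψ) = Γ (V.U t ψ) := by
  refine hV.map_comm hQ (fun x z hxz => ?_) t ψ
  obtain ⟨y, h1, h2⟩ := mem_graph_square.1 hxz
  refine mem_graph_square.2 ⟨_, hodd.map_mem_graph hΓ hΓu h1, ?_⟩
  simpa using Q.graph.neg_mem (hodd.map_mem_graph hΓ hΓu h2)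

omit [CompleteSpace E] in
theorem superCommutes_iff_mem_graph {a b : E →L[ℂ] E} :
    SuperCommutes Γ Q a b ↔
      ∀ x y, (x, y) ∈ Q.graph → (a x, Γ (a (Γ y)) + b x) ∈ Q.graph := by
  constructor
  · intro h x y hxy
    obtain ⟨⟨x, hx⟩, rfl, rfl⟩ := (LinearPMap.mem_graph_iff _).1 hxy
    obtain ⟨h1, h2⟩ := h ⟨x, hx⟩
    have : Γ (a (Γ (Q ⟨x, hx⟩))) = _ := h2
    rw [this, sub_add_cancel]
    exact Q.mem_graph ⟨a x, h1⟩
  · rintro h ⟨x, hx⟩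
    have h1 := h _ _ (Q.mem_graph ⟨x, hx⟩)
    have h2 := LinearPMap.mem_domain_of_mem_graph h1
    refine ⟨h2, ?_⟩
    have h3 := Q.mem_graph_snd_inj (Q.mem_graph ⟨a x, h2⟩) h1 rfl
    rw [h3, add_sub_cancel_right]
    rfl

-- Only matrix elements of `a` and `b` occur, so the relation passes to integrals and `σ`-weak
-- limits.
include hΓ in
theorem superCommutes_iff_inner (hQ : IsSelfAdjoint Q) {a b : E →L[ℂ] E} :
    SuperCommutes Γ Q a b ↔ ∀ x y, (x, y) ∈ Q.graph → ∀ u v, (u, v) ∈ Q.graph →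
      inner ℂ v (a x) = inner ℂ (Γ u) (a (Γ y)) + inner ℂ u (b x) := by
  rw [superCommutes_iff_mem_graph]
  simp only [mem_graph_iff_of_isSelfAdjoint hQ (x := a _), inner_add_right,
    inner_grading_left hΓ]

end Odd

/-! ### Smearing -/

namespace UnitaryGroup

variable (V : UnitaryGroup E)

omit [CompleteSpace E] in
theorem integrable_inner_conj {f : ℝ → ℂ} (hf : MeasureTheory.Integrable f) (a : E →L[ℂ] E)
    (φ ψ : E) :
    MeasureTheory.Integrable fun t => f t * inner ℂ (V.U (-t) φ) (a (V.U (-t) ψ)) := by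
  refine ((V.integrable_conj hf a ψ).const_inner φ).congr (Filter.Eventually.of_forall fun t => ?_)
  simp only
  rw [inner_smul_right, V.inner_map_right]

theorem inner_smear {f : ℝ → ℂ} (hf : MeasureTheory.Integrable f) (a : E →L[ℂ] E)
    (φ ψ : E) :
    inner ℂ φ (V.smear a f ψ) = ∫ t, f t * inner ℂ (V.U (-t) φ) (a (V.U (-t) ψ)) := by
  rw [V.smear_apply a hf, ← integral_inner (V.integrable_conj hf a ψ)]
  simp only [inner_smul_right, V.inner_map_right]

omit [CompleteSpace E] in
theorem norm_smear_le {f : ℝ → ℂ} (hf : MeasureTheory.Integrable f) (a : E →L[ℂ] E) :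
    ‖V.smear a f‖ ≤ (∫ t, ‖f t‖) * ‖a‖ := by
  rw [smear, dif_pos hf]
  exact LinearMap.mkContinuous_norm_le _
    (mul_nonneg (MeasureTheory.integral_nonneg fun _ => norm_nonneg _) (norm_nonneg _)) _

theorem integrable_ofReal_normed (φ : ContDiffBump (0 : ℝ)) :
    MeasureTheory.Integrable fun t => ((φ.normed MeasureTheory.volume t : ℝ) : ℂ) :=
  φ.integrable_normed.ofReal

/-- If `f` runs through a sequence of mollifiers then `a_f` converges strongly to `a`. -/
theorem tendsto_smear_normed {φ : ℕ → ContDiffBump (0 : ℝ)}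
    (hφ : Filter.Tendsto (fun n => (φ n).rOut) Filter.atTop (nhds 0)) (a : E →L[ℂ] E) (ψ : E) :
    Filter.Tendsto
      (fun n => V.smear a (fun t => (((φ n).normed MeasureTheory.volume t : ℝ) : ℂ)) ψ)
      Filter.atTop (nhds (a ψ)) := by
  have hc : Continuous fun t => V.U (-t) (a (V.U t ψ)) := by
    simpa [Function.comp_def] using (V.continuous_conj a ψ).comp continuous_neg
  have h := ContDiffBump.convolution_tendsto_right_of_continuous (μ := MeasureTheory.volume)
    hφ hc 0
  simp only [neg_zero, V.zero, one_apply_eq_self] at h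
  refine h.congr fun n => ?_
  rw [V.smear_apply a (integrable_ofReal_normed (φ n)), MeasureTheory.convolution]
  refine MeasureTheory.integral_congr_ae (Filter.Eventually.of_forall fun t => ?_)
  simp

omit [CompleteSpace E] in
theorem norm_smear_normed_le (φ : ContDiffBump (0 : ℝ)) (a : E →L[ℂ] E) :
    ‖V.smear a (fun t => ((φ.normed MeasureTheory.volume t : ℝ) : ℂ))‖ ≤ ‖a‖ := by
  refine (V.norm_smear_le (integrable_ofReal_normed φ) a).trans_eq ?_
  have : ∀ t, ‖((φ.normed MeasureTheory.volume t : ℝ) : ℂ)‖ = φ.normed MeasureTheory.volume t :=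
    fun t => by rw [Complex.norm_real, Real.norm_of_nonneg (φ.nonneg_normed t)]
  simp only [this, φ.integral_normed, one_mul]

end UnitaryGroup

/-! ### Time smoothing and powers of the superderivation. -/

section Smear

variable {Γ : E →L[ℂ] E} (hΓ : IsSelfAdjoint Γ) (hΓu : Γ ∈ unitary (E →L[ℂ] E))
  (hQ : IsSelfAdjoint Q) (hodd : IsOdd Γ Q)
  {V : UnitaryGroup E} (hV : V.HasGenerator (square Q))

include hΓ hΓu hQ hodd hV

/-- Time smoothing commutes with the superderivation. -/
theorem SuperCommutes.smear {a b : E →L[ℂ] E} (h : SuperCommutes Γ Q a b) {f : ℝ → ℂ}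
    (hf : MeasureTheory.Integrable f) : SuperCommutes Γ Q (V.smear a f) (V.smear b f) := by
  rw [superCommutes_iff_inner hΓ hQ] at h ⊢
  intro x y hxy u v huv
  rw [V.inner_smear hf, V.inner_smear hf, V.inner_smear hf,
    ← MeasureTheory.integral_add (V.integrable_inner_conj hf _ _ _)
      (V.integrable_inner_conj hf _ _ _)]
  congr 1
  funext t
  rw [h _ _ (hV.map_mem_graph_sqrt hQ hxy (-t)) _ _ (hV.map_mem_graph_sqrt hQ huv (-t)),
    hV.map_grading_comm hΓ hΓu hodd hQ, hV.map_grading_comm hΓ hΓu hodd hQ]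
  ring

-- Weak form of `δ² = [Q², ·]`. The relation is used at `(x, v)` and at `(Γy, Γu)`; both produce
-- `⟨Γv, aΓy⟩`, which cancels in the difference.
omit hV in
theorem SuperCommutes.inner_square {a b : E →L[ℂ] E} (h : SuperCommutes Γ Q a b) {x y z u v w : E}
    (hxy : (x, y) ∈ Q.graph) (hyz : (y, z) ∈ Q.graph) (huv : (u, v) ∈ Q.graph)
    (hvw : (v, w) ∈ Q.graph) :
    inner ℂ v (b x) - inner ℂ (Γ u) (b (Γ y)) = inner ℂ w (a x) - inner ℂ u (a z) := by
  rw [superCommutes_iff_inner hΓ hQ] at h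
  have h1 := h _ _ hxy _ _ hvw
  have h2 := h _ _ (hodd.map_mem_graph hΓ hΓu hyz) _ _ (hodd.map_mem_graph hΓ hΓu huv)
  simp only [map_neg, grading_involutive hΓ hΓu, inner_neg_left, inner_neg_right] at h2
  linear_combination h1 - h2 - 2 * h1 + 2 * h2

/-- The square of the superderivation is the commutator with `Q²`: after smoothing, it is
differentiation in time. -/
theorem SuperCommutes.smear_deriv {a b : E →L[ℂ] E} (h : SuperCommutes Γ Q a b) {f : ℝ → ℂ}
    (hf : ContDiff ℝ 1 f) (hfc : HasCompactSupport f) :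
    SuperCommutes Γ Q (V.smear b f) (Complex.I • V.smear a (deriv f)) := by
  have hfi : MeasureTheory.Integrable f := hf.continuous.integrable_of_hasCompactSupport hfc
  have hfi' : MeasureTheory.Integrable (deriv f) :=
    (hf.continuous_deriv le_rfl).integrable_of_hasCompactSupport hfc.deriv
  -- The identity is proved first on `D(Q²)`, where the pairings are differentiable in time.
  have key : ∀ x y z u v w, (x, y) ∈ Q.graph → (y, z) ∈ Q.graph → (u, v) ∈ Q.graph →
      (v, w) ∈ Q.graph → inner ℂ v (V.smear b f x) = inner ℂ (Γ u) (V.smear b f (Γ y)) +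
        inner ℂ u ((Complex.I • V.smear a (deriv f)) x) := by
    intro x y z u v w hxy hyz huv hvw
    have hd := hV.hasDerivAt_inner (mem_graph_square.2 ⟨y, hxy, hyz⟩)
      (mem_graph_square.2 ⟨v, huv, hvw⟩) a
    have hi : MeasureTheory.Integrable fun t => f t *
        (Complex.I * (inner ℂ (V.U (-t) w) (a (V.U (-t) x)) -
          inner ℂ (V.U (-t) u) (a (V.U (-t) z)))) := by
      refine (((V.integrable_inner_conj hfi a w x).sub
        (V.integrable_inner_conj hfi a u z)).const_mul Complex.I).congr
        (Filter.Eventually.of_forall fun t => ?_)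
      simp only [Pi.sub_apply]
      ring
    -- Integrability of all three products removes the boundary terms.
    have hp := MeasureTheory.integral_mul_deriv_eq_deriv_mul_of_integrable
      (fun t _ => (hf.differentiable one_ne_zero t).hasDerivAt) (fun t _ => hd t) hi
      (V.integrable_inner_conj hfi' a u x) (V.integrable_inner_conj hfi a u x)
    rw [smul_apply, inner_smul_right, V.inner_smear hfi', V.inner_smear hfi, V.inner_smear hfi,
      ← neg_eq_iff_eq_neg.2 hp, ← sub_eq_iff_eq_add',
      ← MeasureTheory.integral_sub (V.integrable_inner_conj hfi _ _ _)
      (V.integrable_inner_conj hfi _ _ _), ← MeasureTheory.integral_neg,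
      ← MeasureTheory.integral_const_mul]
    congr 1
    funext t
    have := h.inner_square hΓ hΓu hQ hodd (hV.map_mem_graph_sqrt hQ hxy (-t))
      (hV.map_mem_graph_sqrt hQ hyz (-t)) (hV.map_mem_graph_sqrt hQ huv (-t))
      (hV.map_mem_graph_sqrt hQ hvw (-t))
    rw [← this, hV.map_grading_comm hΓ hΓu hodd hQ, hV.map_grading_comm hΓ hΓu hodd hQ]
    linear_combination (f t * (inner ℂ (V.U (-t) v) (b (V.U (-t) x)) -
      inner ℂ (Γ (V.U (-t) u)) (b (Γ (V.U (-t) y))))) * Complex.I_sq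
  rw [superCommutes_iff_inner hΓ hQ]
  intro x y hxy u v huv
  -- `D(Q²)` is a core for `Q`: in the coordinates `x = Aξ`, `Qx = ξ - iAξ`, it corresponds to `ξ ∈
  -- D(Q)`. Both sides are continuous in `(ξ, η)`, so density suffices.
  set A := resolventI hQ 1 one_ne_zero with hA
  have hAr : ∀ {x y}, (x, y) ∈ Q.graph → ∃ ξ, x = A ξ ∧ y = ξ - Complex.I • A ξ := fun {x y} h => by
    have := resolventI_of_mem_graph hQ (one_ne_zero (α := ℝ)) h
    rw [Complex.ofReal_one, mul_one] at this
    exact ⟨_, this.symm, by rw [hA, this]; abel⟩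
  obtain ⟨ξ, rfl, rfl⟩ := hAr hxy
  obtain ⟨η, rfl, rfl⟩ := hAr huv
  clear hxy huv
  have hdr : DenseRange fun p : Q.domain => (p : E) := hQ.dense_domain.denseRange_val
  refine hdr.induction_on₂ (p := fun ξ η => inner ℂ (η - Complex.I • A η) (V.smear b f (A ξ)) =
    inner ℂ (Γ (A η)) (V.smear b f (Γ (ξ - Complex.I • A ξ))) +
      inner ℂ (A η) ((Complex.I • V.smear a (deriv f)) (A ξ)))
    (isClosed_eq (by fun_prop) (by fun_prop)) ?_ ξ η
  intro ξ η
  have hA' : ∀ ξ, (A ξ, ξ - Complex.I • A ξ) ∈ Q.graph := fun ξ => by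
    simpa using resolventI_mem_graph hQ one_ne_zero ξ
  have hA2 : ∀ ξ : Q.domain, ∃ z, (ξ - Complex.I • A ξ, z) ∈ Q.graph := fun ξ =>
    ⟨_, Q.graph.sub_mem (Q.mem_graph ξ) (Q.graph.smul_mem Complex.I (hA' ξ))⟩
  obtain ⟨z, hz⟩ := hA2 ξ
  obtain ⟨w, hw⟩ := hA2 η
  exact key _ _ _ _ _ _ (hA' ξ) hz (hA' η) hw

end Smear

theorem mem_powDomain_succ {M : Type*} [AddCommGroup M] [Module ℂ M] {T : M →ₗ.[ℂ] M} {n : ℕ}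
    {x : M} : x ∈ powDomain T (n + 1) ↔ ∃ y, (x, y) ∈ T.graph ∧ y ∈ powDomain T n := by
  constructor
  · rintro ⟨x, hx, rfl⟩
    exact ⟨T x, T.mem_graph x, hx⟩
  · rintro ⟨y, h, hy⟩
    obtain ⟨x, rfl, rfl⟩ := (LinearPMap.mem_graph_iff _).1 h
    exact ⟨x, hy, rfl⟩

theorem smear_mem_smoothDomain {Γ : E →L[ℂ] E} (hΓ : IsSelfAdjoint Γ)
    (hΓu : Γ ∈ unitary (E →L[ℂ] E)) (hQ : IsSelfAdjoint Q) (hodd : IsOdd Γ Q)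
    {V : UnitaryGroup E} (hV : V.HasGenerator (square Q)) {a b : E →L[ℂ] E}
    (h : SuperCommutes Γ Q a b) {f : ℝ → ℂ} (hf : ContDiff ℝ ∞ f) (hfc : HasCompactSupport f) :
    V.smear a f ∈ smoothDomain (superderivation Γ Q) := by
  -- The induction needs `a_f` and `b_f` together and all `f` at once, since `δ` sends `a_f` to
  -- `b_f` and `b_f` to `i a_{f'}`.
  have key : ∀ n (f : ℝ → ℂ), ContDiff ℝ ∞ f → HasCompactSupport f →
      V.smear a f ∈ powDomain (superderivation Γ Q) n ∧
      V.smear b f ∈ powDomain (superderivation Γ Q) n := by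
    intro n
    induction n with
    | zero => exact fun _ _ _ => ⟨trivial, trivial⟩
    | succ n ih =>
      intro f hf hfc
      refine ⟨mem_powDomain_succ.2 ⟨_, (mem_graph_superderivation hQ.dense_domain).2
        (h.smear hΓ hΓu hQ hodd hV (hf.continuous.integrable_of_hasCompactSupport hfc)),
        (ih f hf hfc).2⟩, mem_powDomain_succ.2 ⟨_, (mem_graph_superderivation hQ.dense_domain).2
        (h.smear_deriv hΓ hΓu hQ hodd hV (hf.of_le (by simp)) hfc), ?_⟩⟩
      exact Submodule.smul_mem _ _ (ih (deriv f) ((contDiff_infty_iff_deriv.1 hf).2) hfc.deriv).1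
  exact Submodule.mem_iInf _ |>.2 fun n => (key (n + 1) f hf hfc).1

end SuperDer

/-! ### `σ`-weak convergence and closedness. -/

namespace SuperDer

section SigmaWeak

variable {E : Type*} [NormedAddCommGroup E] [InnerProductSpace ℂ E]

theorem norm_inner_apply_le (a : E →L[ℂ] E) {C : ℝ} (hC : ‖a‖ ≤ C) (ξ η : E) :
    ‖inner ℂ ξ (a η)‖ ≤ C * (‖ξ‖ * ‖η‖) := by
  have h1 := norm_inner_le_norm (𝕜 := ℂ) ξ (a η)
  have h2 := a.le_of_opNorm_le hC η
  calc _ ≤ ‖ξ‖ * ‖a η‖ := h1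
    _ ≤ ‖ξ‖ * (C * ‖η‖) := by gcongr
    _ = _ := by ring

omit [InnerProductSpace ℂ E] in
theorem summable_norm_mul_norm (p q : lp (fun _ : ℕ => E) 2) :
    Summable fun n => ‖p n‖ * ‖q n‖ := by
  have h : ∀ p : lp (fun _ : ℕ => E) 2, Summable fun n => ‖p n‖ ^ 2 := fun p => by
    simpa using (lp.memℓp p).summable (by norm_num)
  refine Summable.of_nonneg_of_le (fun n => by positivity) (fun n => ?_) ((h p).add (h q))
  nlinarith [sq_nonneg (‖p n‖ - ‖q n‖), sq_nonneg (‖p n‖), sq_nonneg (‖q n‖)]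

/-- A bounded strongly convergent sequence of operators converges `σ`-weakly. -/
theorem tendsto_sigmaWeak_of_tendsto_apply {a : ℕ → E →L[ℂ] E} {b : E →L[ℂ] E} {C : ℝ}
    (hC : ∀ n, ‖a n‖ ≤ C)
    (h : ∀ ψ, Filter.Tendsto (fun n => a n ψ) Filter.atTop (nhds (b ψ))) :
    Filter.Tendsto a Filter.atTop (@nhds _ (sigmaWeakTopology E) b) := by
  rw [nhds_induced, Filter.tendsto_comap_iff, tendsto_pi_nhds]
  intro p
  refine tendsto_tsum_of_dominated_convergence (bound := fun n => C * (‖p.1 n‖ * ‖p.2 n‖))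
    ((summable_norm_mul_norm p.1 p.2).mul_left C) (fun k => Filter.Tendsto.inner tendsto_const_nhds (h _))
    (Filter.Eventually.of_forall fun n k => norm_inner_apply_le _ (hC n) _ _)

/-- Sequences supported at index `0` reduce the defining functionals to single matrix elements. -/
theorem continuous_sigmaWeak_inner_apply (φ ψ : E) :
    @Continuous _ _ (sigmaWeakTopology E) _ fun a : E →L[ℂ] E => inner ℂ φ (a ψ) := by
  have h := @Continuous.comp _ _ _ (sigmaWeakTopology E) _ _ _ _ (continuous_apply
    ((lp.single 2 0 φ, lp.single 2 0 ψ) : lp (fun _ : ℕ => E) 2 × lp (fun _ : ℕ => E) 2))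
    (continuous_induced_dom (f := fun (a : E →L[ℂ] E)
      (p : lp (fun _ : ℕ => E) 2 × lp (fun _ : ℕ => E) 2) =>
      ∑' n : ℕ, inner ℂ (p.1 n) (a (p.2 n))) (t := Pi.topologicalSpace))
  convert h using 1
  funext a
  simp only [Function.comp_apply]
  rw [tsum_eq_single 0 fun n hn => by simp [lp.single_apply, hn]]
  simp [lp.single_apply]

/-- An abstract `T` allows use with the `σ`-weak topology, which is not the instance on `E →L[ℂ] E`.
-/
theorem isClosed_setOf_eq_add {T : Type*} [TopologicalSpace T] {F G K : T → ℂ}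
    (hF : Continuous F) (hG : Continuous G) (hK : Continuous K) :
    IsClosed {p : T × T | F p.1 = G p.1 + K p.2} :=
  isClosed_eq (hF.comp continuous_fst) ((hG.comp continuous_fst).add (hK.comp continuous_snd))

theorem mem_closure_prod_of_tendsto {T : Type*} [TopologicalSpace T] {S : Set (T × T)}
    {a b : ℕ → T} {x y : T} (ha : Filter.Tendsto a Filter.atTop (nhds x))
    (hb : Filter.Tendsto b Filter.atTop (nhds y)) (h : ∀ n, (a n, b n) ∈ S) :
    (x, y) ∈ closure S :=
  mem_closure_of_tendsto (ha.prodMk_nhds hb) (Filter.Eventually.of_forall h)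

theorem superCommutes_of_mem_closure [CompleteSpace E] {Q : E →ₗ.[ℂ] E} {Γ : E →L[ℂ] E}
    (hΓ : IsSelfAdjoint Γ) (hQ : IsSelfAdjoint Q) {S : Set ((E →L[ℂ] E) × (E →L[ℂ] E))}
    (hS : ∀ p ∈ S, SuperCommutes Γ Q p.1 p.2) {p : (E →L[ℂ] E) × (E →L[ℂ] E)}
    (hp : p ∈ @closure _ (@instTopologicalSpaceProd _ _ (sigmaWeakTopology E)
      (sigmaWeakTopology E)) S) : SuperCommutes Γ Q p.1 p.2 := by
  rw [superCommutes_iff_inner hΓ hQ]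
  intro x y hxy u v huv
  have hcl := @isClosed_setOf_eq_add _ (sigmaWeakTopology E) _ _ _
    (continuous_sigmaWeak_inner_apply v x) (continuous_sigmaWeak_inner_apply (Γ u) (Γ y))
    (continuous_sigmaWeak_inner_apply u x)
  refine @closure_minimal _ (@instTopologicalSpaceProd _ _ (sigmaWeakTopology E)
      (sigmaWeakTopology E)) _ _ ?_ hcl p hp
  exact fun q hq => (superCommutes_iff_inner hΓ hQ).1 (hS q hq) x y hxy u v huv

end SigmaWeak

theorem exists_contDiffBump_tendsto_zero : ∃ φ : ℕ → ContDiffBump (0 : ℝ),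
    Filter.Tendsto (fun n => (φ n).rOut) Filter.atTop (nhds 0) :=
  ⟨fun n => ⟨1 / ((n : ℝ) + 1) / 2, 1 / ((n : ℝ) + 1), by positivity, half_lt_self (by positivity)⟩,
    tendsto_one_div_add_atTop_nhds_zero_nat⟩

variable {E : Type*} [NormedAddCommGroup E] [InnerProductSpace ℂ E] [CompleteSpace E]
  {Q : E →ₗ.[ℂ] E} {Γ : E →L[ℂ] E}

/-! ### The core property and strong density. -/

section Regularization

variable (hΓ : IsSelfAdjoint Γ) (hΓu : Γ ∈ unitary (E →L[ℂ] E))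
  (hQ : IsSelfAdjoint Q) (hodd : IsOdd Γ Q)
  {V : UnitaryGroup E} (hV : V.HasGenerator (square Q))

include hΓ hΓu hQ hodd hV

theorem smear_normed_mem_smoothDomain {a b : E →L[ℂ] E} (h : SuperCommutes Γ Q a b)
    (φ : ContDiffBump (0 : ℝ)) :
    V.smear a (fun t => ((φ.normed MeasureTheory.volume t : ℝ) : ℂ)) ∈
      smoothDomain (superderivation Γ Q) :=
  smear_mem_smoothDomain hΓ hΓu hQ hodd hV h
    (Complex.ofRealCLM.contDiff.comp φ.contDiff_normed)
    (φ.hasCompactSupport_normed.comp_left Complex.ofReal_zero)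

theorem isSigmaWeakCore_smoothDomain :
    IsSigmaWeakCore (superderivation Γ Q) (smoothDomain (superderivation Γ Q)) := by
  have hS : smoothDomain (superderivation Γ Q) ≤ (superderivation Γ Q).domain := fun a ha => by
    obtain ⟨b, hb, -⟩ := mem_powDomain_succ.1 (Submodule.mem_iInf _ |>.1 ha 0)
    exact LinearPMap.mem_domain_of_mem_graph hb
  have hle : (superderivation Γ Q).domRestrict (smoothDomain (superderivation Γ Q)) ≤
      superderivation Γ Q := LinearPMap.domRestrict_le
  have hle := LinearPMap.le_graph_of_le hle
  refine ⟨hS, Set.Subset.antisymm (fun p hp => ?_) ?_⟩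
  · exact (mem_graph_superderivation hQ.dense_domain).2 (superCommutes_of_mem_closure hΓ hQ
      (fun q hq => (mem_graph_superderivation hQ.dense_domain).1 (hle hq)) hp)
  · rintro ⟨a, b⟩ hab
    have hab : SuperCommutes Γ Q a b := (mem_graph_superderivation hQ.dense_domain).1 hab
    obtain ⟨φ, hφ⟩ := exists_contDiffBump_tendsto_zero
    have hlim : ∀ a : E →L[ℂ] E, Filter.Tendsto
        (fun n => V.smear a (fun t => (((φ n).normed MeasureTheory.volume t : ℝ) : ℂ)))
        Filter.atTop (@nhds _ (sigmaWeakTopology E) a) := fun a =>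
      tendsto_sigmaWeak_of_tendsto_apply (fun n => V.norm_smear_normed_le (φ n) a)
        (V.tendsto_smear_normed hφ a)
    refine @mem_closure_prod_of_tendsto _ (sigmaWeakTopology E) _ _ _ _ _ (hlim a) (hlim b)
      fun n => ?_
    have h1 := smear_normed_mem_smoothDomain hΓ hΓu hQ hodd hV hab (φ n)
    have h2 := (mem_graph_superderivation hQ.dense_domain).2
      (hab.smear hΓ hΓu hQ hodd hV (UnitaryGroup.integrable_ofReal_normed (φ n)))
    obtain ⟨⟨a', ha'⟩, h3, h4⟩ := (LinearPMap.mem_graph_iff _).1 h2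
    simp only at h3 h4
    subst h3
    rw [← h4]
    exact ((superderivation Γ Q).domRestrict (smoothDomain (superderivation Γ Q))).mem_graph
      ⟨_, h1, ha'⟩

-- With `B = (Q + ic)⁻¹`, both `QB` and the extension of `BQ` equal `1 - icB`. Moving `Q` through
-- `Γ` gives `δ(BaB) = (QB)aB + ΓBa(BQ)Γ`, and expanding yields the witness.
omit hV in
theorem exists_superCommutes_resolventI {c : ℝ} (hc : c ≠ 0) (a : E →L[ℂ] E) :
    ∃ b, SuperCommutes Γ Q (resolventI hQ c hc * a * resolventI hQ c hc) b := by
  set B := resolventI hQ c hc with hB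
  refine ⟨a * B - (Complex.I * c) • (B * a * B) + Γ * B * a * Γ -
    (Complex.I * c) • (Γ * B * a * B * Γ), superCommutes_iff_mem_graph.2 fun x y hxy => ?_⟩
  have h1 : B (Γ y) = (Complex.I * c) • B (Γ x) - Γ x := by
    have := resolventI_of_mem_graph hQ hc (hodd.map_mem_graph hΓ hΓu hxy)
    rw [← hB, map_add, map_neg, map_smul] at this
    nth_rw 2 [← this]
    abel
  convert resolventI_mem_graph hQ hc (a (B x)) using 1
  simp only [← hB, mul_apply_eq_comp, h1, map_sub, map_smul, add_apply, sub_apply, smul_apply,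
    Prod.mk.injEq, true_and]
  abel

omit hΓ hΓu hodd hV in
theorem norm_smul_resolventI_le (n : ℕ) (ψ : E) : ‖(Complex.I * ((n + 1 : ℝ) : ℂ)) •
    resolventI hQ (n + 1) n.cast_add_one_ne_zero ψ‖ ≤ ‖ψ‖ := by
  have h := norm_resolventI_le hQ (c := n + 1) n.cast_add_one_ne_zero ψ
  have hn : (0 : ℝ) < n + 1 := by positivity
  rw [abs_of_pos hn, inv_mul_eq_div, le_div_iff₀' hn] at h
  rw [norm_smul, norm_mul, Complex.norm_I, one_mul, Complex.norm_real, Real.norm_of_nonneg hn.le]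
  exact h

-- On `D(Q)` the error is `-(Q + ic)⁻¹Qχ`, of order `1/c`; uniform contractivity extends convergence
-- to all vectors.
omit hΓ hΓu hodd hV in
theorem tendsto_resolventI_apply (ψ : E) : Filter.Tendsto
    (fun n : ℕ => (Complex.I * ((n + 1 : ℝ) : ℂ)) • resolventI hQ (n + 1) n.cast_add_one_ne_zero ψ)
    Filter.atTop (nhds ψ) := by
  rw [Metric.tendsto_atTop']
  intro ε hε
  obtain ⟨χ, hχ, hψχ⟩ := hQ.dense_domain.exists_dist_lt ψ (ε := ε / 3) (by positivity)
  have hlim : Filter.Tendsto (fun n : ℕ => 1 / ((n : ℝ) + 1) * ‖Q ⟨χ, hχ⟩‖) Filter.atTop (nhds 0) := by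
    simpa using tendsto_one_div_add_atTop_nhds_zero_nat.mul_const ‖Q ⟨χ, hχ⟩‖
  obtain ⟨N, hN⟩ := Filter.eventually_atTop.1 (hlim.eventually_lt_const (show 0 < ε / 3 by positivity))
  refine ⟨N, fun n hn => ?_⟩
  have hn := hN n hn.le
  set B := resolventI hQ ((n : ℝ) + 1) n.cast_add_one_ne_zero with hB
  have h1 := norm_smul_resolventI_le hQ n (ψ - χ)
  have h2 : ‖B (Q ⟨χ, hχ⟩)‖ ≤ 1 / ((n : ℝ) + 1) * ‖Q ⟨χ, hχ⟩‖ := by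
    have := norm_resolventI_le hQ (c := n + 1) n.cast_add_one_ne_zero (Q ⟨χ, hχ⟩)
    rwa [abs_of_pos (by positivity), inv_eq_one_div] at this
  have h3 := resolventI_of_mem_graph hQ (c := n + 1) n.cast_add_one_ne_zero (Q.mem_graph ⟨χ, hχ⟩)
  rw [← hB, map_add, map_smul] at h3
  have e : (Complex.I * ((n + 1 : ℝ) : ℂ)) • B ψ - ψ =
      (Complex.I * ((n + 1 : ℝ) : ℂ)) • B (ψ - χ) - B (Q ⟨χ, hχ⟩) - (ψ - χ) := by
    rw [map_sub, smul_sub]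
    rw [eq_sub_of_add_eq h3]
    abel
  rw [dist_eq_norm] at hψχ ⊢
  rw [e]
  calc _ ≤ ‖(Complex.I * ((n + 1 : ℝ) : ℂ)) • B (ψ - χ)‖ + ‖B (Q ⟨χ, hχ⟩)‖ + ‖ψ - χ‖ :=
        (norm_sub_le _ _).trans (by gcongr; exact norm_sub_le _ _)
    _ < ε := by linarith

theorem isStronglyDense_smoothDomain :
    IsStronglyDense (smoothDomain (superderivation Γ Q)) := by
  set ι := ContinuousLinearMap.toPointwiseConvergenceCLM ℂ (RingHom.id ℂ) E E with hι
  have hlim : ∀ {a : ℕ → E →L[ℂ] E} {b : E →L[ℂ] E},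
      (∀ ψ, Filter.Tendsto (fun n => a n ψ) Filter.atTop (nhds (b ψ))) →
      Filter.Tendsto (fun n => ι (a n)) Filter.atTop (nhds (ι b)) := fun h =>
    PointwiseConvergenceCLM.tendsto_iff_forall_tendsto.2 h
  have h1 : ∀ a b, SuperCommutes Γ Q a b →
      ι a ∈ closure (ι '' (smoothDomain (superderivation Γ Q) : Set (E →L[ℂ] E))) := by
    intro a b hab
    obtain ⟨φ, hφ⟩ := exists_contDiffBump_tendsto_zero
    exact mem_closure_of_tendsto (hlim (V.tendsto_smear_normed hφ a))
      (Filter.Eventually.of_forall fun n =>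
        ⟨_, smear_normed_mem_smoothDomain hΓ hΓu hQ hodd hV hab (φ n), rfl⟩)
  intro x
  obtain ⟨a, rfl⟩ : ∃ a, ι a = x := ⟨x, rfl⟩
  -- Two limits are taken: `a` by elements of `D(δ)`, and those by smooth ones.
  rw [← closure_closure]
  let B : ℕ → E →L[ℂ] E := fun n =>
    (Complex.I * ((n + 1 : ℝ) : ℂ)) • resolventI hQ (n + 1) n.cast_add_one_ne_zero
  have hB : ∀ ψ, Filter.Tendsto (fun n => B n ψ) Filter.atTop (nhds ψ) :=
    tendsto_resolventI_apply hQ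
  have hBn : ∀ n ψ, ‖B n ψ‖ ≤ ‖ψ‖ := norm_smul_resolventI_le hQ
  have h2 : ∀ ψ, Filter.Tendsto (fun n => (B n * a * B n) ψ) Filter.atTop (nhds (a ψ)) := by
    intro ψ
    have h3 : Filter.Tendsto (fun n => B n (a (B n ψ) - a ψ)) Filter.atTop (nhds 0) := by
      refine squeeze_zero_norm (fun n => hBn n _) ?_
      rw [← tendsto_zero_iff_norm_tendsto_zero, tendsto_sub_nhds_zero_iff]
      exact (a.continuous.tendsto ψ).comp (hB ψ)
    simpa using h3.add (hB (a ψ))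
  refine mem_closure_of_tendsto (hlim h2) (Filter.Eventually.of_forall fun n => ?_)
  obtain ⟨b, hb⟩ := exists_superCommutes_resolventI hΓ hΓu hQ hodd
    (c := n + 1) n.cast_add_one_ne_zero a
  set c := Complex.I * ((n + 1 : ℝ) : ℂ)
  have hb' : SuperCommutes Γ Q (B n * a * B n) ((c * c) • b) := by
    have : B n * a * B n = (c * c) • (resolventI hQ (n + 1) n.cast_add_one_ne_zero * a *
        resolventI hQ (n + 1) n.cast_add_one_ne_zero) := by
      simp only [B, c, smul_mul_assoc, mul_smul_comm, smul_smul]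
    rw [this]
    exact (superderivationGraph Γ Q).smul_mem (c * c) (x := (_, b)) hb
  exact h1 _ _ hb'

end Regularization

end SuperDer

theorem mainTheorem9 {E : Type*} [NormedAddCommGroup E] [InnerProductSpace ℂ E] [CompleteSpace E]
    (Γ : E →L[ℂ] E) (hΓ : IsSelfAdjoint Γ) (hΓu : Γ ∈ unitary (E →L[ℂ] E))
    (Q : E →ₗ.[ℂ] E) (hQ : IsSelfAdjoint Q) (hodd : SuperDer.IsOdd Γ Q) :
    (SuperDer.expI (SuperDer.square Q)).HasGenerator (SuperDer.square Q) ∧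
    (∀ a ∈ (SuperDer.superderivation Γ Q).domain,
      ∀ f : ℝ → ℂ, ContDiff ℝ ∞ f → HasCompactSupport f →
        (SuperDer.expI (SuperDer.square Q)).smear a f ∈
          SuperDer.smoothDomain (SuperDer.superderivation Γ Q)) ∧
    SuperDer.IsSigmaWeakCore (SuperDer.superderivation Γ Q)
      (SuperDer.smoothDomain (SuperDer.superderivation Γ Q)) ∧
    SuperDer.IsStronglyDense (SuperDer.smoothDomain (SuperDer.superderivation Γ Q)) := by
  have hV := SuperDer.hasGenerator_expI hQ
  refine ⟨hV, fun a ha f hf hfc => ?_,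
    SuperDer.isSigmaWeakCore_smoothDomain hΓ hΓu hQ hodd hV,
    SuperDer.isStronglyDense_smoothDomain hΓ hΓu hQ hodd hV⟩
  obtain ⟨b, hb⟩ := LinearPMap.mem_domain_iff.1 ha
  exact SuperDer.smear_mem_smoothDomain hΓ hΓu hQ hodd hV
    ((SuperDer.mem_graph_superderivation hQ.dense_domain).1 hb) hf hfc
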